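/- Terminology. A smooth Fano $n$-polytope is a convex lattice polytope $P\subset\mathbb R^n$ that contains the origin in its interior and such that the vertex set of each facet is a $\mathbb Z$-basis of $\mathbb Z^n$; $V(P)$ is its vertex set. Two polytopes $P,Q\subset\mathbb R^n$ are unimodularly equivalent if an affine map $\phi$ of $\mathbb R^n$ with $\phi(\mathbb Z^n)=\mathbb Z^n$ satisfies $\phi(P)=Q$. Smooth Fano $n$-polytopes $P,Q$ are I-equivalent if there are smooth Fano $n$-polytopes $P_0,\dots,P_m$ such that $P$ and $Q$ are unimodularly equivalent to $P_0$ and $P_m$ respectively and, for each $1\le i\le m$, one of $V(P_{i-1})$, $V(P_i)$ is obtained from the other by adding one new lattice point $w$. They are F-equivalent if moreover each such step is a stellar subdivision or the inverse of one: if $P''$ arises from $P'$ by adding the vertex $w$, then $P'$ has a proper face $F$ with $w=\sum_{v\in V(F)}v$ and the facets of $P''$ containing $w$ are exactly the polytopes $\operatorname{conv}(\{w\}\cup(V(F')\setminus\{v\}))$ with $F'$ a facet of $P'$, $F\subset F'$ and $v\in V(F)$. A smooth Fano $n$-polytope $P$ is I-isolated (resp. F-isolated) if every smooth Fano $n$-polytope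 that is I-equivalent (resp. F-equivalent) to $P$ is unimodularly equivalent to $P$. The fan $\Sigma(P)$ consists of the cones generated by the proper faces of $P$ (the empty face generates $\{0\}$). A primitive collection of $P$ is a nonempty set $A\subset V(P)$ that does not generate a cone of $\Sigma(P)$ although $A\setminus\{x\}$ does for every $x\in A$. Its primitive relation is the relation $\sum_{x\in A}x=c_1x_1+\dots+c_mx_m$ with $m\ge 0$, integers $c_i>0$ and distinct vertices $x_1,\dots,x_m$ of $P$ that generate a cone of $\Sigma(P)$ (the right-hand side is $0$ if $m=0$). Theorem. Let $a\ge 2$, $b\ge 1$, $k\ge 1$ and $l_1,\dots,l_k\ge 1$ be integers and put $n=a+2b-1+\sum_{j=1}^k l_j$. Let each $\alpha_{i,j}$ ($1\le j\le k$, $1\le i\le l_j$) be one of the symbols $y_1,\dots,y_b,u_1,\dots,u_b$, repetitions being allowed, in such a way that each of these $2b$ symbols occurs, i.e. $\{\alpha_{i,j}\}=\{y_q,u_q:1\le q\le b\}$ (so that $\sum_j l_j\ge 2b$). Then there exists a smooth Fano $n$-polytope $P$ that is I-isolated, and hence F-isolated, with exactly $n+k+3$ vertices $$V(P)=\{v_1,\dots,v_a,y_1,\dots,y_b,z,t,u_1,\dots,u_b\}\cup\bigcup_{j=1}^k\{w_{1,j},\dots,w_{l_j+1,j}\},$$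 whose primitive relations are exactly $$\begin{aligned} v_1+\dots+v_a+y_1+\dots+y_b&=(a+b-1)t,\\ y_1+\dots+y_b+z&=u_1+\dots+u_b,\\ z+t&=0,\\ t+u_1+\dots+u_b&=y_1+\dots+y_b,\\ u_1+\dots+u_b+v_1+\dots+v_a&=(a+b-2)t,\\ w_{1,j}+\dots+w_{l_j+1,j}&=\alpha_{1,j}+\dots+\alpha_{l_j,j}\qquad(1\le j\le k). \end{aligned}$$ -/

import Mathlib

namespace FanoPolytope

/-- The lattice `ℤ ^ n` inside `ℝ ^ n`. -/
def intLattice (n : ℕ) : Set (Fin n → ℝ) :=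
  Set.range (fun (z : Fin n → ℤ) (i : Fin n) => (z i : ℝ))

/-- A lattice polytope: the convex hull of finitely many lattice points. -/
def IsLatticePolytope {n : ℕ} (P : Set (Fin n → ℝ)) : Prop :=
  ∃ S : Set (Fin n → ℝ), S.Finite ∧ S ⊆ intLattice n ∧ P = convexHull ℝ S

/-- The set `V(P)` of vertices of `P` (also used for the faces of `P`). -/
def vertexSet {n : ℕ} (P : Set (Fin n → ℝ)) : Set (Fin n → ℝ) :=
  Set.extremePoints ℝ P

/-- A face of `P` different from `P`; the empty face is allowed. -/
def IsProperFace {n : ℕ} (P F : Set (Fin n → ℝ)) : Prop :=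
  IsExposed ℝ P F ∧ F ≠ P

/-- A facet of the `n`-dimensional polytope `P`: a face of dimension `n - 1`. -/
def IsFacet {n : ℕ} (P F : Set (Fin n → ℝ)) : Prop :=
  IsExposed ℝ P F ∧ F.Nonempty ∧ Module.finrank ℝ (vectorSpan ℝ F) + 1 = n

/-- A smooth Fano polytope in `ℝ ^ n`: a lattice polytope that contains the origin in its interior
and such that the vertex set of each facet is a `ℤ`-basis of `ℤ ^ n`. -/
structure IsSmoothFano {n : ℕ} (P : Set (Fin n → ℝ)) : Prop where
  isLatticePolytope : IsLatticePolytope P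
  zero_mem_interior : (0 : Fin n → ℝ) ∈ interior P
  facet_basis : ∀ F : Set (Fin n → ℝ), IsFacet P F →
    ∃ e : Module.Basis (Fin n) ℤ (Fin n → ℤ),
      vertexSet F = Set.range (fun (k : Fin n) (i : Fin n) => (e k i : ℝ))

/-- Unimodular equivalence: an affine map that preserves the lattice carries `P` onto `Q`. -/
def UnimodEquiv {n : ℕ} (P Q : Set (Fin n → ℝ)) : Prop :=
  ∃ φ : (Fin n → ℝ) →ᵃ[ℝ] (Fin n → ℝ), φ '' intLattice n = intLattice n ∧ φ '' P = Q

/-- `V(Q) = V(P) ∪ {w}` for a lattice point `w` which is not a vertex of `P`. -/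
def AddsVertex {n : ℕ} (P Q : Set (Fin n → ℝ)) (w : Fin n → ℝ) : Prop :=
  w ∈ intLattice n ∧ w ∉ vertexSet P ∧ vertexSet Q = vertexSet P ∪ {w}

/-- `Q` arises from `P` by a stellar subdivision with the new vertex `w`: there is a proper face `F`
of `P` such that `w` is the sum of the vertices of `F` and the facets of `Q` that contain `w` are
the polytopes `conv ({w} ∪ (V(F') \ {v}))` with `F'` a facet of `P`, `F ⊆ F'`, `v ∈ V(F)`. -/
def IsStellar {n : ℕ} (P Q : Set (Fin n → ℝ)) (w : Fin n → ℝ) : Prop :=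
  ∃ F : Set (Fin n → ℝ), IsProperFace P F ∧ w = ∑ᶠ v ∈ vertexSet F, v ∧
    {G : Set (Fin n → ℝ) | IsFacet Q G ∧ w ∈ G} =
      {G : Set (Fin n → ℝ) | ∃ F' v, IsFacet P F' ∧ F ⊆ F' ∧ v ∈ vertexSet F ∧
        G = convexHull ℝ ({w} ∪ (vertexSet F' \ {v}))}

/-- One step of an I-equivalence: a vertex is added or removed. -/
def IStep {n : ℕ} (P Q : Set (Fin n → ℝ)) : Prop :=
  ∃ w : Fin n → ℝ, AddsVertex P Q w ∨ AddsVertex Q P w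

/-- One step of an F-equivalence: a vertex is added by a stellar subdivision, or removed by the
inverse of one. -/
def FStep {n : ℕ} (P Q : Set (Fin n → ℝ)) : Prop :=
  ∃ w : Fin n → ℝ, (AddsVertex P Q w ∧ IsStellar P Q w) ∨ (AddsVertex Q P w ∧ IsStellar Q P w)

/-- There is a sequence `R 0, …, R m` of smooth Fano polytopes, consecutive ones being related by
`step`, whose ends are unimodularly equivalent to `P` and `Q`. -/
def Joined {n : ℕ} (step : Set (Fin n → ℝ) → Set (Fin n → ℝ) → Prop)
    (P Q : Set (Fin n → ℝ)) : Prop :=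
  ∃ (m : ℕ) (R : ℕ → Set (Fin n → ℝ)), (∀ i ≤ m, IsSmoothFano (R i)) ∧
    UnimodEquiv P (R 0) ∧ UnimodEquiv Q (R m) ∧ ∀ i < m, step (R i) (R (i + 1))

/-- I-equivalence of smooth Fano polytopes. -/
def IEquiv {n : ℕ} (P Q : Set (Fin n → ℝ)) : Prop := Joined IStep P Q

/-- F-equivalence of smooth Fano polytopes. -/
def FEquiv {n : ℕ} (P Q : Set (Fin n → ℝ)) : Prop := Joined FStep P Q

/-- `P` is I-isolated: no smooth Fano polytope outside of its unimodular equivalence class is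
I-equivalent to it. -/
def IsIIsolated {n : ℕ} (P : Set (Fin n → ℝ)) : Prop :=
  ∀ Q : Set (Fin n → ℝ), IsSmoothFano Q → ¬ UnimodEquiv P Q → ¬ IEquiv P Q

/-- `P` is F-isolated: no smooth Fano polytope outside of its unimodular equivalence class is
F-equivalent to it. -/
def IsFIsolated {n : ℕ} (P : Set (Fin n → ℝ)) : Prop :=
  ∀ Q : Set (Fin n → ℝ), IsSmoothFano Q → ¬ UnimodEquiv P Q → ¬ FEquiv P Q

/-- The fan `Σ(P)`: the cones generated by the proper faces of `P` (the empty face gives `0`). -/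
def fan {n : ℕ} (P : Set (Fin n → ℝ)) : Set (PointedCone ℝ (Fin n → ℝ)) :=
  {σ | ∃ F : Set (Fin n → ℝ), IsProperFace P F ∧ σ = PointedCone.hull ℝ F}

/-- A primitive collection of `P`: a nonempty set `A` of vertices which does not generate a cone
of the fan although each `A \ {x}` with `x ∈ A` does. -/
def IsPrimitiveCollection {n : ℕ} (P : Set (Fin n → ℝ)) (A : Finset (Fin n → ℝ)) : Prop :=
  A.Nonempty ∧ (A : Set (Fin n → ℝ)) ⊆ vertexSet P ∧
    PointedCone.hull ℝ (A : Set (Fin n → ℝ)) ∉ fan P ∧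
    ∀ x ∈ A, PointedCone.hull ℝ ((A : Set (Fin n → ℝ)) \ {x}) ∈ fan P

/-- The formal sum `∑ i, x i` of a family of vectors, an element of the free commutative monoid on
the vectors. -/
noncomputable def formalSum {n : ℕ} {ι : Type*} [Fintype ι] (x : ι → Fin n → ℝ) :
    (Fin n → ℝ) →₀ ℕ :=
  ∑ i, Finsupp.single (x i) 1

/-- `∑ x ∈ A, x = ∑ y, c y • y` is the primitive relation of the primitive collection `A`: the `y`
with `c y > 0` are vertices of `P` that generate a cone of the fan. The relation is recorded as the
pair of `A` and the formal sum `c`; `c = 0` stands for `∑ x ∈ A, x = 0`. -/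
def IsPrimitiveRelation {n : ℕ} (P : Set (Fin n → ℝ))
    (r : Finset (Fin n → ℝ) × ((Fin n → ℝ) →₀ ℕ)) : Prop :=
  IsPrimitiveCollection P r.1 ∧ (r.2.support : Set (Fin n → ℝ)) ⊆ vertexSet P ∧
    PointedCone.hull ℝ (r.2.support : Set (Fin n → ℝ)) ∈ fan P ∧
    ∑ x ∈ r.1, x = r.2.sum (fun y m => m • y)

end FanoPolytope

/-!
Label the vertices by `v i`, `y q`, `z`, `t`, `u q`, `w j i`. The primitive collections are the
edges of the pentagon with the blocks `v, y, z, t, u` as its corners, and the blocks `w j`. A facet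
therefore leaves out one vertex of each of three blocks that cover the edges of the pentagon, which
gives five kinds of facets `vyt, yzu, ztv, tuy, uvz`, and one vertex of each block `w j`. A linear
functional is the same as a function on the labels that satisfies the linear relations
(`IsRel`, `IsConfig`), so that the functional of each facet can be written down (`facetVal`). Since
all primitive relations have positive degree, there are no other facets (`IsRel.exists_lt_one`,
`IsConfig.exists_eq_fn`), and since the relations can be solved over `ℤ` for the vertices left out
by a facet (`IsRel.eq_zero`), the polytope is smooth.

For isolation it suffices that no smooth Fano polytope arises by adding a vertex to, or removing a
vertex from, a polytope with these relations: an equivalence is linear because the origin is the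
only lattice point in the interior, so it preserves the relations. The tool is the neighbouring
facet across a ridge, `IsSmoothFanoSet.exists_neighbor`: if `x₀` is a vertex of the facet `g = 1`
with coordinate functional `d`, then the neighbour arises by exchanging `x₀` for a vertex `x'` with
`d x' = -1`, and it has the functional `g + (g x' - 1) d`.

* Removing a vertex. If a vertex `v i`, `w j i` or `z` is removed, then the origin is not in the
  interior any more. If `t`, `y q` or `u q` is removed, then a facet that does not contain it is
  still a facet, and the relations leave no possibility for one of its neighbours. For `y q` and
  `u q` this uses that they occur in the relation of some block `w j`
  (`IsConfig.not_removable`).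
* Adding a vertex `x`. If `x` is beyond one of two adjacent facets and not beyond the other, then
  the wall between them has degree at least two, and `x` has the coordinate `-1` in the direction of
  the wall, with respect to the facet it is not beyond (`IsSmoothFanoSet.neighbor_eq_of_beyond`,
  `IsConfig.wall`). The facets of the four kinds other than `tuy` are connected by walls of degree
  one, so `x` is beyond all of them or none. Considering the facets whose cones contain `x` and
  `-x`, one is led to a facet of kind `tuy` and its neighbours of the kinds `yzu` and `vyt`, where
  the conditions on the coordinates are contradictory because of `a ≥ 2`
  (`IsConfig.not_addable`).
-/

/-! ### Facet functionals of lattice polytopes -/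

namespace FanoPolytope

variable {n : ℕ}

/-- A linear functional defining a facet of the convex hull of `V`: it is at most `1` on `V`, and
the points of `V` where it equals `1` span the space. -/
def IsFacetFn (V : Set (Fin n → ℝ)) (g : (Fin n → ℝ) →ₗ[ℝ] ℝ) : Prop :=
  (∀ x ∈ V, g x ≤ 1) ∧ Submodule.span ℝ {x ∈ V | g x = 1} = ⊤

/-- The finite-set counterpart of `IsSmoothFano`: the properties of the vertex set of a smooth Fano
polytope, with facets replaced by the functionals that define them. -/
structure IsSmoothFanoSet (V : Set (Fin n → ℝ)) : Prop where
  finite : V.Finite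
  subset_lattice : V ⊆ intLattice n
  eq_zero_of_nonneg : ∀ f : (Fin n → ℝ) →ₗ[ℝ] ℝ, (∀ x ∈ V, 0 ≤ f x) → f = 0
  facet_basis : ∀ g : (Fin n → ℝ) →ₗ[ℝ] ℝ, IsFacetFn V g →
    ∃ e : Module.Basis (Fin n) ℤ (Fin n → ℤ),
      {x ∈ V | g x = 1} = Set.range (fun (k : Fin n) (i : Fin n) => (e k i : ℝ))

lemma convexHull_vertexSet_of_finite {S : Set (Fin n → ℝ)} (hS : S.Finite) :
    convexHull ℝ (vertexSet (convexHull ℝ S)) = convexHull ℝ S := by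
  have h1 := closure_convexHull_extremePoints (hS.isCompact_convexHull ℝ) (convex_convexHull ℝ S)
  have h2 : (vertexSet (convexHull ℝ S)).Finite := hS.subset (extremePoints_convexHull_subset (𝕜 := ℝ))
  exact (h2.isClosed_convexHull ℝ).closure_eq.symm.trans h1

lemma IsLatticePolytope.finite_vertexSet {P : Set (Fin n → ℝ)} (hP : IsLatticePolytope P) :
    (vertexSet P).Finite := by
  obtain ⟨S, hS, -, rfl⟩ := hP
  exact hS.subset (extremePoints_convexHull_subset (𝕜 := ℝ))

lemma IsLatticePolytope.vertexSet_subset {P : Set (Fin n → ℝ)} (hP : IsLatticePolytope P) :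
    vertexSet P ⊆ intLattice n := by
  obtain ⟨S, hS, hl, rfl⟩ := hP
  exact (extremePoints_convexHull_subset (𝕜 := ℝ)).trans hl

lemma IsLatticePolytope.convexHull_vertexSet {P : Set (Fin n → ℝ)} (hP : IsLatticePolytope P) :
    convexHull ℝ (vertexSet P) = P := by
  obtain ⟨S, hS, hl, rfl⟩ := hP
  exact convexHull_vertexSet_of_finite hS

lemma le_of_mem_convexHull {V : Set (Fin n → ℝ)} {g : (Fin n → ℝ) →ₗ[ℝ] ℝ} {c : ℝ}
    (h : ∀ x ∈ V, g x ≤ c) {x : Fin n → ℝ} (hx : x ∈ convexHull ℝ V) : g x ≤ c :=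
  convexHull_min (t := {x | g x ≤ c}) h (convex_halfSpace_le g.isLinear c) hx

/-- A functional bounded by `1` exposes the set where it equals `1`, the empty set included. -/
lemma isExposed_eq_one {V : Set (Fin n → ℝ)} {g : (Fin n → ℝ) →ₗ[ℝ] ℝ}
    (h : ∀ x ∈ V, g x ≤ 1) : IsExposed ℝ (convexHull ℝ V) {x ∈ convexHull ℝ V | g x = 1} := by
  rintro ⟨x₀, hx₀, hx₀'⟩
  refine ⟨LinearMap.toContinuousLinearMap g, ?_⟩
  ext x
  simp only [Set.mem_ofPred_eq, LinearMap.coe_toContinuousLinearMap', and_congr_right_iff]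
  intro hx
  constructor
  · intro h1 y hy
    rw [h1]
    exact le_of_mem_convexHull h hy
  · intro h1
    exact le_antisymm (le_of_mem_convexHull h hx) (hx₀' ▸ h1 x₀ hx₀)

lemma eq_zero_of_nonneg_of_mem_interior {P : Set (Fin n → ℝ)}
    (h0 : (0 : Fin n → ℝ) ∈ interior P) (f : (Fin n → ℝ) →ₗ[ℝ] ℝ) (hf : ∀ x ∈ P, 0 ≤ f x) :
    f = 0 := by
  refine LinearMap.ext fun x => ?_
  have hc : Filter.Tendsto (fun s : ℝ => s • x) (nhds 0) (nhds 0) := by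
    have : Continuous (fun s : ℝ => s • x) := by fun_prop
    simpa using this.tendsto 0
  obtain ⟨ε, hε, hb⟩ := Metric.eventually_nhds_iff.1
    (hc.eventually (mem_interior_iff_mem_nhds.1 h0))
  have e1 := hf _ (hb (y := ε / 2) (by simp [abs_of_pos hε]; linarith))
  have e2 := hf _ (hb (y := -(ε / 2)) (by simp [abs_of_pos hε]; linarith))
  simp only [map_smul, smul_eq_mul] at e1 e2
  have : f x = 0 := by nlinarith
  simpa using this

/-- A nonempty exposed proper subset of a set with the origin in its interior is cut out by a
functional with maximum `1`. -/
lemma exists_eq_one_of_isExposed {P F : Set (Fin n → ℝ)} (h0 : (0 : Fin n → ℝ) ∈ interior P)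
    (hF : IsExposed ℝ P F) (hne : F.Nonempty) (hFP : F ≠ P) :
    ∃ g : (Fin n → ℝ) →ₗ[ℝ] ℝ, (∀ x ∈ P, g x ≤ 1) ∧ F = {x ∈ P | g x = 1} := by
  obtain ⟨l, hl⟩ := hF hne
  obtain ⟨x₀, hx₀⟩ := hne
  have hx₀' := hl ▸ hx₀
  have hpos : 0 < l x₀ := by
    rcases (show 0 ≤ l x₀ by simpa using hx₀'.2 0 (interior_subset h0)).lt_or_eq with h | h
    · exact h
    · exfalso
      apply hFP
      have hz := eq_zero_of_nonneg_of_mem_interior h0 (-(l : (Fin n → ℝ) →ₗ[ℝ] ℝ))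
        (fun x hx => by simpa [← h] using hx₀'.2 x hx)
      have hz' : ∀ x, l x = 0 := fun x => by simpa using LinearMap.congr_fun hz x
      rw [hl]
      ext x
      simp [hz']
  refine ⟨(l x₀)⁻¹ • (l : (Fin n → ℝ) →ₗ[ℝ] ℝ), ?_, ?_⟩
  · intro x hx
    have := hx₀'.2 x hx
    simp only [LinearMap.smul_apply, ContinuousLinearMap.coe_coe, smul_eq_mul]
    rw [inv_mul_le_iff₀ hpos]
    linarith
  · rw [hl]
    ext x
    simp only [Set.mem_ofPred_eq, LinearMap.smul_apply, ContinuousLinearMap.coe_coe, smul_eq_mul,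
      and_congr_right_iff]
    intro hx
    rw [inv_mul_eq_one₀ hpos.ne']
    constructor
    · intro h
      exact le_antisymm (h x₀ hx₀'.1) (hx₀'.2 x hx)
    · intro h y hy
      rw [← h]
      exact hx₀'.2 y hy

lemma IsLatticePolytope.convexHull_eq {P : Set (Fin n → ℝ)} (hP : IsLatticePolytope P) :
    convexHull ℝ P = P := by
  obtain ⟨S, -, -, rfl⟩ := hP
  exact (convex_convexHull ℝ S).convexHull_eq

lemma vertexSet_eq_one {P : Set (Fin n → ℝ)} (hP : IsLatticePolytope P)
    {g : (Fin n → ℝ) →ₗ[ℝ] ℝ} (h : ∀ x ∈ P, g x ≤ 1) :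
    vertexSet {x ∈ P | g x = 1} = {x ∈ vertexSet P | g x = 1} := by
  have he : IsExposed ℝ P {x ∈ P | g x = 1} := by
    have := isExposed_eq_one (V := P) (g := g) h
    rwa [hP.convexHull_eq] at this
  have := he.isExtreme.extremePoints_eq
  unfold vertexSet
  rw [this]
  ext x
  simp only [Set.mem_inter_iff, Set.mem_ofPred_eq]
  constructor
  · rintro ⟨⟨-, h⟩, h'⟩
    exact ⟨h', h⟩
  · rintro ⟨h, h'⟩
    exact ⟨⟨extremePoints_subset h, h'⟩, h⟩

lemma convexHull_vertexSet_eq_one {P : Set (Fin n → ℝ)} (hP : IsLatticePolytope P)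
    {g : (Fin n → ℝ) →ₗ[ℝ] ℝ} (h : ∀ x ∈ P, g x ≤ 1) :
    convexHull ℝ {x ∈ vertexSet P | g x = 1} = {x ∈ P | g x = 1} := by
  have hc := hP.convexHull_eq
  have hcomp : IsCompact P := by
    obtain ⟨S, hS, -, rfl⟩ := hP
    exact hS.isCompact_convexHull ℝ
  have hcv : Convex ℝ P := hc ▸ convex_convexHull ℝ P
  have he : IsExposed ℝ P {x ∈ P | g x = 1} := by
    have := isExposed_eq_one (V := P) (g := g) h
    rwa [hc] at this
  have h1 := closure_convexHull_extremePoints (he.isCompact hcomp) (he.convex hcv)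
  have h2 := vertexSet_eq_one hP h
  unfold vertexSet at h2
  rw [h2] at h1
  rw [← h1]
  exact ((hP.finite_vertexSet.subset (Set.sep_subset _ _)).isClosed_convexHull ℝ).closure_eq.symm

lemma ne_zero_of_eq_one {g : (Fin n → ℝ) →ₗ[ℝ] ℝ} {x : Fin n → ℝ} (h : g x = 1) : g ≠ 0 := by
  rintro rfl
  simp at h

/-- A nonempty subset of the hyperplane `g = 1` spans the space linearly exactly if it spans the
hyperplane affinely. -/
lemma finrank_vectorSpan_iff {F : Set (Fin n → ℝ)} {g : (Fin n → ℝ) →ₗ[ℝ] ℝ}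
    (h : ∀ x ∈ F, g x = 1) (hne : F.Nonempty) :
    Module.finrank ℝ (vectorSpan ℝ F) + 1 = n ↔ Submodule.span ℝ F = ⊤ := by
  obtain ⟨x₀, hx₀⟩ := hne
  have hg : g ≠ 0 := ne_zero_of_eq_one (h x₀ hx₀)
  have hker := Module.Dual.finrank_ker_add_one_of_ne_zero (f := g) hg
  rw [Module.finrank_fin_fun] at hker
  have hle : vectorSpan ℝ F ≤ LinearMap.ker g := by
    rw [vectorSpan_def, Submodule.span_le]
    rintro _ ⟨x, hx, y, hy, rfl⟩
    simp [h x hx, h y hy]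
  constructor
  · intro hr
    have heq : vectorSpan ℝ F = LinearMap.ker g :=
      Submodule.eq_of_le_of_finrank_eq hle (by omega)
    rw [eq_top_iff]
    intro x _
    have h1 : x - g x • x₀ ∈ vectorSpan ℝ F := by
      rw [heq]
      simp [h x₀ hx₀]
    have h2 : vectorSpan ℝ F ≤ Submodule.span ℝ F := by
      rw [vectorSpan_def, Submodule.span_le]
      rintro _ ⟨x, hx, y, hy, rfl⟩
      exact Submodule.sub_mem _ (Submodule.subset_span hx) (Submodule.subset_span hy)
    have := Submodule.add_mem _ (h2 h1) (Submodule.smul_mem _ (g x) (Submodule.subset_span hx₀))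
    simpa using this
  · intro hs
    have heq : vectorSpan ℝ F = LinearMap.ker g := by
      refine le_antisymm hle ?_
      intro x hx
      have hx' : x ∈ Submodule.span ℝ F := hs ▸ Submodule.mem_top
      have key : ∀ y ∈ Submodule.span ℝ F, y - g y • x₀ ∈ vectorSpan ℝ F := by
        intro y hy
        induction hy using Submodule.span_induction with
        | mem y hy =>
          rw [h y hy, one_smul]
          exact vsub_mem_vectorSpan ℝ hy hx₀
        | zero => simp
        | add y z _ _ hy hz =>
          have := Submodule.add_mem _ hy hz
          convert this using 1
          rw [map_add, add_smul]
          abel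
        | smul c y _ hy =>
          have := Submodule.smul_mem _ c hy
          convert this using 1
          rw [map_smul, smul_sub, smul_eq_mul, mul_smul]
      have := key x hx'
      rwa [LinearMap.mem_ker.1 hx, zero_smul, sub_zero] at this
    rw [heq, hker]

lemma span_convexHull (S : Set (Fin n → ℝ)) :
    Submodule.span ℝ (convexHull ℝ S) = Submodule.span ℝ S :=
  le_antisymm (Submodule.span_le.2 (convexHull_min Submodule.subset_span
    (Submodule.convex _))) (Submodule.span_mono (subset_convexHull ℝ S))

/-- Facets of a lattice polytope around the origin are exactly the sets cut out by the facet
functionals of its vertex set. -/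
lemma isFacet_iff {P : Set (Fin n → ℝ)} (hn : 0 < n) (hP : IsLatticePolytope P)
    (h0 : (0 : Fin n → ℝ) ∈ interior P) (F : Set (Fin n → ℝ)) :
    IsFacet P F ↔ ∃ g, IsFacetFn (vertexSet P) g ∧ F = {x ∈ P | g x = 1} := by
  constructor
  · rintro ⟨he, hne, hr⟩
    have hFP : F ≠ P := by
      rintro rfl
      have h1 : affineSpan ℝ F = ⊤ := affineSpan_eq_top_of_nonempty_interior (by
        rw [hP.convexHull_eq]
        exact ⟨0, h0⟩)
      have h2 := AffineSubspace.vectorSpan_eq_top_of_affineSpan_eq_top ℝ (Fin n → ℝ) (Fin n → ℝ) h1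
      rw [h2, finrank_top, Module.finrank_fin_fun] at hr
      omega
    obtain ⟨g, hg1, hg2⟩ := exists_eq_one_of_isExposed h0 he hne hFP
    refine ⟨g, ⟨fun x hx => hg1 x (extremePoints_subset hx), ?_⟩, hg2⟩
    rw [← span_convexHull, convexHull_vertexSet_eq_one hP hg1, ← hg2]
    refine (finrank_vectorSpan_iff (g := g) ?_ hne).1 hr
    intro x hx
    rw [hg2] at hx
    exact hx.2
  · rintro ⟨g, ⟨hg1, hg2⟩, rfl⟩
    have hg1' : ∀ x ∈ P, g x ≤ 1 := by
      intro x hx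
      rw [← hP.convexHull_vertexSet] at hx
      exact le_of_mem_convexHull hg1 hx
    have hspan : Submodule.span ℝ {x ∈ P | g x = 1} = ⊤ := by
      rw [← convexHull_vertexSet_eq_one hP hg1', span_convexHull, hg2]
    have hne : {x ∈ P | g x = 1}.Nonempty := by
      rw [Set.nonempty_iff_ne_empty]
      intro h
      rw [h, Submodule.span_empty] at hspan
      have : Nonempty (Fin n) := ⟨⟨0, hn⟩⟩
      exact bot_ne_top hspan
    refine ⟨?_, hne, (finrank_vectorSpan_iff (g := g) (fun x hx => hx.2) hne).2 hspan⟩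
    have := isExposed_eq_one hg1
    rwa [hP.convexHull_vertexSet] at this

theorem IsSmoothFano.isSmoothFanoSet {P : Set (Fin n → ℝ)} (hn : 0 < n) (hP : IsSmoothFano P) :
    IsSmoothFanoSet (vertexSet P) where
  finite := hP.isLatticePolytope.finite_vertexSet
  subset_lattice := hP.isLatticePolytope.vertexSet_subset
  eq_zero_of_nonneg := by
    intro f hf
    refine eq_zero_of_nonneg_of_mem_interior hP.zero_mem_interior f ?_
    intro x hx
    rw [← hP.isLatticePolytope.convexHull_vertexSet] at hx
    have := le_of_mem_convexHull (g := -f) (c := 0) (by simpa using hf) hx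
    simpa using this
  facet_basis := by
    intro g hg
    have hle : ∀ x ∈ P, g x ≤ 1 := by
      intro x hx
      rw [← hP.isLatticePolytope.convexHull_vertexSet] at hx
      exact le_of_mem_convexHull hg.1 hx
    rw [← vertexSet_eq_one hP.isLatticePolytope hle]
    exact hP.facet_basis _ ((isFacet_iff hn hP.isLatticePolytope hP.zero_mem_interior _).2
      ⟨g, hg, rfl⟩)

/-- Conversely, a smooth Fano set whose hull contains the origin is the vertex set of a smooth Fano
polytope, if it consists of vertices. -/
theorem IsSmoothFanoSet.isSmoothFano {V : Set (Fin n → ℝ)} (hn : 0 < n) (hV : IsSmoothFanoSet V)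
    (h0 : (0 : Fin n → ℝ) ∈ convexHull ℝ V) (hv : vertexSet (convexHull ℝ V) = V) :
    IsSmoothFano (convexHull ℝ V) := by
  have hL : IsLatticePolytope (convexHull ℝ V) := ⟨V, hV.finite, hV.subset_lattice, rfl⟩
  have hspan : Submodule.span ℝ V = ⊤ := by
    by_contra hne
    obtain ⟨f, hf, hle⟩ := Submodule.exists_le_ker_of_lt_top _ (lt_top_iff_ne_top.2 hne)
    refine hf (hV.eq_zero_of_nonneg f ?_)
    intro x hx
    exact (LinearMap.mem_ker.1 (hle (Submodule.subset_span hx))).ge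
  have haff : affineSpan ℝ V = ⊤ := by
    have hne : V.Nonempty := convexHull_nonempty_iff.1 ⟨0, h0⟩
    rw [AffineSubspace.affineSpan_eq_top_iff_vectorSpan_eq_top_of_nonempty _ _ _ hne, eq_top_iff,
      ← hspan, Submodule.span_le, ← direction_affineSpan]
    intro x hx
    simpa using AffineSubspace.vsub_mem_direction (subset_affineSpan ℝ V hx)
      (convexHull_subset_affineSpan V h0)
  have hint : (0 : Fin n → ℝ) ∈ interior (convexHull ℝ V) := by
    by_contra hni
    have hi := interior_convexHull_nonempty_iff_affineSpan_eq_top.2 haff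
    obtain ⟨f, hf⟩ := geometric_hahn_banach_open_point (convex_convexHull ℝ V).interior
      isOpen_interior hni
    have hle : ∀ x ∈ convexHull ℝ V, f x ≤ 0 := by
      intro x hx
      have hx' : x ∈ closure (interior (convexHull ℝ V)) := by
        rw [(convex_convexHull ℝ V).closure_interior_eq_closure_of_nonempty_interior hi]
        exact subset_closure hx
      refine closure_minimal (t := {x | f x ≤ 0}) ?_ (isClosed_le f.continuous continuous_const) hx'
      intro y hy
      simpa using (hf y hy).le
    have := hV.eq_zero_of_nonneg (-(f : (Fin n → ℝ) →ₗ[ℝ] ℝ)) (by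
      intro x hx
      simpa using hle x (subset_convexHull ℝ V hx))
    obtain ⟨y, hy⟩ := hi
    have h1 := hf y hy
    have h2 := LinearMap.congr_fun this y
    simp at h1 h2
    linarith
  refine ⟨hL, hint, ?_⟩
  intro F hF
  obtain ⟨g, hg, rfl⟩ := (isFacet_iff hn hL hint F).1 hF
  rw [hv] at hg
  obtain ⟨e, he⟩ := hV.facet_basis g hg
  refine ⟨e, ?_⟩
  rw [vertexSet_eq_one hL (fun x hx => le_of_mem_convexHull hg.1 hx), hv, he]

end FanoPolytope

/-! ### Neighbouring facets and cones over facets -/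

namespace FanoPolytope

variable {n : ℕ} {V : Set (Fin n → ℝ)} {g : (Fin n → ℝ) →ₗ[ℝ] ℝ}

/-- The inclusion of `ℤ ^ n` in `ℝ ^ n`. -/
def latticeIncl (n : ℕ) : (Fin n → ℤ) →+ (Fin n → ℝ) :=
  AddMonoidHom.compLeft (Int.castAddHom ℝ) (Fin n)

lemma mem_intLattice_iff {x : Fin n → ℝ} : x ∈ intLattice n ↔ ∃ m, latticeIncl n m = x := Iff.rfl

namespace IsSmoothFanoSet

lemma facet_basis' (hV : IsSmoothFanoSet V) (hg : IsFacetFn V g) :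
    ∃ e : Module.Basis (Fin n) ℤ (Fin n → ℤ),
      {x ∈ V | g x = 1} = Set.range (fun k => latticeIncl n (e k)) :=
  hV.facet_basis g hg

/-- A functional that is integral on a facet is integral on the lattice. -/
lemma exists_int_of_facet (hV : IsSmoothFanoSet V) (hg : IsFacetFn V g)
    (f : (Fin n → ℝ) →ₗ[ℝ] ℝ) (hf : ∀ x ∈ V, g x = 1 → ∃ m : ℤ, f x = m)
    {x : Fin n → ℝ} (hx : x ∈ intLattice n) : ∃ m : ℤ, f x = m := by
  obtain ⟨e, he⟩ := hV.facet_basis' hg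
  have hk : ∀ k, ∃ m : ℤ, f (latticeIncl n (e k)) = m := by
    intro k
    have : latticeIncl n (e k) ∈ {x ∈ V | g x = 1} := he ▸ ⟨k, rfl⟩
    exact hf _ this.1 this.2
  choose m hm using hk
  obtain ⟨y, rfl⟩ := mem_intLattice_iff.1 hx
  refine ⟨∑ k, e.repr y k * m k, ?_⟩
  conv_lhs => rw [← e.sum_repr y]
  rw [map_sum, map_sum]
  push_cast
  refine Finset.sum_congr rfl fun k _ => ?_
  rw [map_zsmul, map_zsmul, hm, zsmul_eq_mul]

lemma exists_int (hV : IsSmoothFanoSet V) (hg : IsFacetFn V g)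
    {x : Fin n → ℝ} (hx : x ∈ intLattice n) : ∃ m : ℤ, g x = m :=
  hV.exists_int_of_facet hg g (fun _ _ h => ⟨1, by simpa using h⟩) hx

lemma le_zero_of_lt_one (hV : IsSmoothFanoSet V) (hg : IsFacetFn V g)
    {x : Fin n → ℝ} (hx : x ∈ intLattice n) (h : g x < 1) : g x ≤ 0 := by
  obtain ⟨m, hm⟩ := hV.exists_int hg hx
  rw [hm] at h ⊢
  have : m < 1 := by exact_mod_cast h
  exact_mod_cast (by omega : m ≤ 0)

lemma ncard_facet (hV : IsSmoothFanoSet V) (hg : IsFacetFn V g) :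
    {x ∈ V | g x = 1}.ncard = n := by
  obtain ⟨e, he⟩ := hV.facet_basis' hg
  have hinj : Function.Injective (fun k => latticeIncl n (e k)) := by
    intro i j hij
    apply e.injective
    funext c
    have := congrFun hij c
    simpa [latticeIncl] using this
  rw [he, ← Set.image_univ, Set.ncard_image_of_injective _ hinj]
  simp

/-- The vertices of a facet form a basis of the ambient real space. -/
lemma exists_basis (hV : IsSmoothFanoSet V) (hg : IsFacetFn V g) :
    ∃ B : Module.Basis (Fin n) ℝ (Fin n → ℝ), {x ∈ V | g x = 1} = Set.range B := by
  obtain ⟨e, he⟩ := hV.facet_basis' hg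
  refine ⟨basisOfTopLeSpanOfCardEqFinrank (fun k => latticeIncl n (e k)) ?_ (by simp), ?_⟩
  · rw [← he, hg.2]
  · simpa only [coe_basisOfTopLeSpanOfCardEqFinrank] using he

/-- The coordinate functional of a vertex of a facet, with respect to the basis formed by the
vertices of this facet. -/
lemma exists_dual (hV : IsSmoothFanoSet V) (hg : IsFacetFn V g) {x₀ : Fin n → ℝ}
    (hx₀ : x₀ ∈ V) (h₀ : g x₀ = 1) :
    ∃ d : (Fin n → ℝ) →ₗ[ℝ] ℝ, d x₀ = 1 ∧ ∀ x ∈ V, g x = 1 → x ≠ x₀ → d x = 0 := by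
  obtain ⟨B, hB⟩ := hV.exists_basis hg
  have : x₀ ∈ {x ∈ V | g x = 1} := ⟨hx₀, h₀⟩
  rw [hB] at this
  obtain ⟨k, rfl⟩ := this
  refine ⟨B.coord k, by simp, ?_⟩
  intro x hx hgx hne
  have : x ∈ {x ∈ V | g x = 1} := ⟨hx, hgx⟩
  rw [hB] at this
  obtain ⟨j, rfl⟩ := this
  have : j ≠ k := fun h => hne (h ▸ rfl)
  simp [this]

lemma functional_ext (hg : IsFacetFn V g) {f f' : (Fin n → ℝ) →ₗ[ℝ] ℝ}
    (h : ∀ x ∈ V, g x = 1 → f x = f' x) : f = f' :=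
  LinearMap.ext_on hg.2 (fun x hx => h x hx.1 hx.2)

/-- The neighbouring facet across the ridge opposite to the vertex `x₀` of a facet. -/
theorem exists_neighbor (hV : IsSmoothFanoSet V) (hg : IsFacetFn V g) {x₀ : Fin n → ℝ}
    (hx₀ : x₀ ∈ V) (h₀ : g x₀ = 1) {d : (Fin n → ℝ) →ₗ[ℝ] ℝ} (hd₀ : d x₀ = 1)
    (hd : ∀ x ∈ V, g x = 1 → x ≠ x₀ → d x = 0) :
    ∃ x' ∈ V, d x' = -1 ∧ g x' < 1 ∧ IsFacetFn V (g + (g x' - 1) • d) ∧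
      ∀ x ∈ V, (g + (g x' - 1) • d) x = 1 ↔ x = x' ∨ (g x = 1 ∧ x ≠ x₀) := by
  have hneg : {x ∈ V | d x < 0}.Nonempty := by
    by_contra hne
    have : d = 0 := hV.eq_zero_of_nonneg d (fun x hx => by
      by_contra hlt
      exact hne ⟨x, hx, not_le.1 hlt⟩)
    simp [this] at hd₀
  -- The pivot: among the points on the negative side of the ridge, the first one that is met when
  -- the supporting hyperplane is rotated about the ridge.
  obtain ⟨x', ⟨hx'V, hx'd⟩, hmin⟩ := Set.exists_min_image _ (fun x => (1 - g x) / (-d x))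
    (hV.finite.subset (Set.sep_subset V (fun x => d x < 0))) hneg
  set s : ℝ := (1 - g x') / (-d x') with hs
  have hgx' : g x' < 1 := by
    refine lt_of_le_of_ne (hg.1 x' hx'V) fun h => ?_
    rcases eq_or_ne x' x₀ with rfl | hne
    · linarith
    · linarith [hd x' hx'V h hne]
  have hs0 : 0 < s := div_pos (by linarith) (by linarith)
  have happ : ∀ x, (g + (-s) • d) x = g x - s * d x := by
    intro x
    simp [sub_eq_add_neg]
  have hx'1 : (g + (-s) • d) x' = 1 := by
    rw [happ, hs]
    have : d x' ≠ 0 := hx'd.ne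
    field_simp
    ring
  have hridge : ∀ x ∈ V, g x = 1 → x ≠ x₀ → (g + (-s) • d) x = 1 := by
    intro x hx h1 h2
    rw [happ, hd x hx h1 h2, h1]
    ring
  have hfacet : IsFacetFn V (g + (-s) • d) := by
    constructor
    · intro x hx
      rw [happ]
      rcases lt_or_ge (d x) 0 with hlt | hge
      · have := hmin x ⟨hx, hlt⟩
        rw [le_div_iff₀ (by linarith)] at this
        linarith
      · nlinarith [hg.1 x hx]
    · rw [eq_top_iff, ← hg.2, Submodule.span_le]
      -- `x₀` is a combination of `x'` and the vertices of the ridge.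
      have hsub : ∀ x ∈ V, g x = 1 → x ≠ x₀ →
          x ∈ Submodule.span ℝ {x ∈ V | (g + (-s) • d) x = 1} :=
        fun x hx h1 h2 => Submodule.subset_span ⟨hx, hridge x hx h1 h2⟩
      have hx'mem : x' ∈ Submodule.span ℝ {x ∈ V | (g + (-s) • d) x = 1} :=
        Submodule.subset_span ⟨hx'V, hx'1⟩
      have key : ∀ y ∈ Submodule.span ℝ {x ∈ V | g x = 1},
          y - d y • x₀ ∈ Submodule.span ℝ {x ∈ V | (g + (-s) • d) x = 1} := by
        intro y hy
        induction hy using Submodule.span_induction with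
        | mem y hy =>
          rcases eq_or_ne y x₀ with rfl | hne
          · simp [hd₀]
          · rw [hd y hy.1 hy.2 hne, zero_smul, sub_zero]
            exact hsub y hy.1 hy.2 hne
        | zero => simp
        | add y z _ _ hy hz =>
          have := Submodule.add_mem _ hy hz
          convert this using 1
          rw [map_add, add_smul]
          abel
        | smul c y _ hy =>
          have := Submodule.smul_mem _ c hy
          convert this using 1
          rw [map_smul, smul_sub, smul_eq_mul, mul_smul]
      have hx₀mem : x₀ ∈ Submodule.span ℝ {x ∈ V | (g + (-s) • d) x = 1} := by
        have h1 := key x' (hg.2 ▸ Submodule.mem_top)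
        have h2 := Submodule.smul_mem _ (-(d x')⁻¹) (Submodule.sub_mem _ h1 hx'mem)
        convert h2 using 1
        have : d x' ≠ 0 := hx'd.ne
        rw [sub_sub_cancel_left, smul_neg, neg_smul, neg_neg, smul_smul, inv_mul_cancel₀ this,
          one_smul]
      intro x hx
      rcases eq_or_ne x x₀ with rfl | hne
      · exact hx₀mem
      · exact hsub x hx.1 hx.2 hne
  have hset : {x ∈ V | (g + (-s) • d) x = 1} = insert x' ({x ∈ V | g x = 1} \ {x₀}) := by
    symm
    refine Set.eq_of_subset_of_ncard_le ?_ ?_ (hV.finite.subset (Set.sep_subset _ _))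
    · rintro x (rfl | ⟨⟨hx, h1⟩, h2⟩)
      · exact ⟨hx'V, hx'1⟩
      · exact ⟨hx, hridge x hx h1 h2⟩
    · have hfin : {x ∈ V | g x = 1}.Finite := hV.finite.subset (Set.sep_subset _ _)
      have hmem : x₀ ∈ {x ∈ V | g x = 1} := ⟨hx₀, h₀⟩
      have hnot : x' ∉ {x ∈ V | g x = 1} \ {x₀} := fun h => hgx'.ne h.1.2
      rw [hV.ncard_facet hfacet, Set.ncard_insert_of_notMem hnot (hfin.subset Set.sdiff_subset),
        Set.ncard_sdiff_singleton_add_one hmem hfin, hV.ncard_facet hg]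
  have hint : ∀ x ∈ intLattice n, ∃ m : ℤ, d x = m := fun x hx =>
    hV.exists_int_of_facet hg d (fun x hx h1 => by
      rcases eq_or_ne x x₀ with rfl | hne
      · exact ⟨1, by simpa using hd₀⟩
      · exact ⟨0, by simpa using hd x hx h1 hne⟩) hx
  have hdx' : d x' = -1 := by
    obtain ⟨c, hc⟩ := hint x' (hV.subset_lattice hx'V)
    -- `d / d x'` is integral on the new facet, hence on the lattice, hence at `x₀`.
    obtain ⟨m, hm⟩ := hV.exists_int_of_facet hfacet ((d x')⁻¹ • d) (fun x hx h1 => by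
      have : x ∈ {x ∈ V | (g + (-s) • d) x = 1} := ⟨hx, h1⟩
      rw [hset] at this
      rcases this with rfl | ⟨h2, h3⟩
      · exact ⟨1, by simp [hx'd.ne]⟩
      · exact ⟨0, by simp [hd x hx h2.2 h3]⟩) (hV.subset_lattice hx₀)
    simp only [LinearMap.smul_apply, smul_eq_mul, hd₀, mul_one, hc] at hm
    have hc0 : (c : ℝ) ≠ 0 := by
      rw [← hc]
      exact hx'd.ne
    have hmc : m * c = 1 := by
      have : (m : ℝ) * c = 1 := by rw [← hm, inv_mul_cancel₀ hc0]
      exact_mod_cast this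
    have hcneg : c < 0 := by
      have : (c : ℝ) < 0 := hc ▸ hx'd
      exact_mod_cast this
    rcases Int.eq_one_or_neg_one_of_mul_eq_one' hmc with h | h
    · omega
    · rw [hc, h.2]
      simp
  have hs' : g x' - 1 = -s := by
    rw [hs, hdx']
    ring
  refine ⟨x', hx'V, hdx', hgx', hs' ▸ hfacet, ?_⟩
  rw [hs']
  intro x hx
  constructor
  · intro h1
    have : x ∈ {x ∈ V | (g + (-s) • d) x = 1} := ⟨hx, h1⟩
    rw [hset] at this
    rcases this with rfl | ⟨h2, h3⟩
    · exact Or.inl rfl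
    · exact Or.inr ⟨h2.2, h3⟩
  · rintro (rfl | ⟨h1, h2⟩)
    · exact hx'1
    · exact hridge x hx h1 h2

lemma finite_facetFn (hV : IsSmoothFanoSet V) : {g | IsFacetFn V g}.Finite := by
  refine Set.Finite.of_finite_image (f := fun g => {x ∈ V | g x = 1}) ?_ ?_
  · refine hV.finite.finite_subsets.subset ?_
    rintro _ ⟨g, -, rfl⟩
    exact Set.sep_subset _ _
  · intro g hg g' hg' h
    refine functional_ext hg fun x hx h1 => ?_
    have : x ∈ {x ∈ V | g' x = 1} := by
      have h : {x ∈ V | g x = 1} = {x ∈ V | g' x = 1} := h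
      rw [← h]
      exact ⟨hx, h1⟩
    rw [h1, this.2]

/-- Every point lies in the cone over some facet: all functionals that are nonnegative on this facet
are nonnegative at the point. -/
theorem exists_facet_cone (hV : IsSmoothFanoSet V) (hne : ∃ g, IsFacetFn V g) (x : Fin n → ℝ) :
    ∃ g, IsFacetFn V g ∧
      ∀ c : (Fin n → ℝ) →ₗ[ℝ] ℝ, (∀ y ∈ V, g y = 1 → 0 ≤ c y) → 0 ≤ c x := by
  obtain ⟨g, hg, hmax⟩ := Set.exists_max_image _ (fun g => g x) hV.finite_facetFn hne
  refine ⟨g, hg, fun c hc => ?_⟩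
  obtain ⟨B, hB⟩ := hV.exists_basis hg
  have hmem : ∀ k, B k ∈ V ∧ g (B k) = 1 := fun k => by
    have : B k ∈ {x ∈ V | g x = 1} := hB ▸ ⟨k, rfl⟩
    exact this
  rw [← B.sum_repr x, map_sum]
  refine Finset.sum_nonneg fun k _ => ?_
  rw [map_smul, smul_eq_mul]
  refine mul_nonneg ?_ (hc _ (hmem k).1 (hmem k).2)
  obtain ⟨x', hx', -, hlt, hg', -⟩ := hV.exists_neighbor hg (hmem k).1 (hmem k).2
    (d := B.coord k) (by simp) (by
      intro y hy h1 hne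
      have : y ∈ {x ∈ V | g x = 1} := ⟨hy, h1⟩
      rw [hB] at this
      obtain ⟨j, rfl⟩ := this
      have : j ≠ k := fun h => hne (h ▸ rfl)
      simp [this])
  have := hmax _ hg'
  simp only [LinearMap.add_apply, LinearMap.smul_apply, smul_eq_mul, Module.Basis.coord_apply]
    at this
  nlinarith

/-- A point of the cone over a facet vanishes if the functional of the facet is not positive. -/
lemma eq_zero_of_cone (hV : IsSmoothFanoSet V) (hg : IsFacetFn V g) {x : Fin n → ℝ}
    (hcone : ∀ c : (Fin n → ℝ) →ₗ[ℝ] ℝ, (∀ y ∈ V, g y = 1 → 0 ≤ c y) → 0 ≤ c x)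
    (hgx : g x ≤ 0) : x = 0 := by
  obtain ⟨B, hB⟩ := hV.exists_basis hg
  have hk : ∀ k, B.repr x k = 0 := by
    intro k
    have hcoord : ∀ y ∈ V, g y = 1 → 0 ≤ B.coord k y ∧ 0 ≤ (g - B.coord k) y := by
      intro y hy h1
      have : y ∈ {x ∈ V | g x = 1} := ⟨hy, h1⟩
      rw [hB] at this
      obtain ⟨j, rfl⟩ := this
      rw [LinearMap.sub_apply, h1]
      rcases eq_or_ne j k with rfl | h
      · simp
      · simp [h]
    have e1 := hcone (B.coord k) (fun y hy h1 => (hcoord y hy h1).1)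
    have e2 := hcone (g - B.coord k) (fun y hy h1 => (hcoord y hy h1).2)
    rw [LinearMap.sub_apply] at e2
    have : B.coord k x = 0 := by linarith
    simpa using this
  rw [← B.sum_repr x]
  simp [hk]

/-- The origin is the only lattice point in the interior of a smooth Fano polytope. -/
theorem eq_zero_of_mem_interior (hV : IsSmoothFanoSet V) (hne : ∃ g, IsFacetFn V g)
    {x : Fin n → ℝ} (hx : x ∈ interior (convexHull ℝ V)) (hxl : x ∈ intLattice n) : x = 0 := by
  obtain ⟨g, hg, hcone⟩ := hV.exists_facet_cone hne x
  have hle : ∀ y ∈ convexHull ℝ V, g y ≤ 1 := fun y hy => le_of_mem_convexHull hg.1 hy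
  have hlt : g x < 1 := by
    have hc : Filter.Tendsto (fun s : ℝ => (1 + s) • x) (nhds 0) (nhds x) := by
      have : Continuous (fun s : ℝ => (1 + s) • x) := by fun_prop
      simpa using this.tendsto 0
    obtain ⟨ε, hε, hb⟩ := Metric.eventually_nhds_iff.1
      (hc.eventually (mem_interior_iff_mem_nhds.1 hx))
    have e1 := hle _ (hb (y := ε / 2) (by simp [abs_of_pos hε]; linarith))
    rw [map_smul, smul_eq_mul] at e1
    by_contra hge
    nlinarith
  exact hV.eq_zero_of_cone hg hcone (hV.le_zero_of_lt_one hg hxl hlt)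

/-- Let `V` be the vertex set of a smooth Fano polytope with vertex `x`, let `g` define a facet that
does not contain `x`, and let `g'` define the neighbouring facet, with the vertex `e` in place of
`x₀`, of the hull of `V \ {x}`. If `x` is beyond the latter facet, then it is the neighbour of `g`
in `V` across the same ridge. -/
theorem neighbor_eq_of_beyond (hV : IsSmoothFanoSet V) (hg : IsFacetFn V g) {x x₀ e : Fin n → ℝ}
    {g' : (Fin n → ℝ) →ₗ[ℝ] ℝ} (hxV : x ∈ V) (hx₀ : x₀ ∈ V) (h₀ : g x₀ = 1)
    (he : e ∈ V) (hge : g e < 1) (hg'V : ∀ y ∈ V, y ≠ x → g' y ≤ 1)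
    (hridge : ∀ y ∈ V, g y = 1 → y ≠ x₀ → g' y = 1) (hg'e : g' e = 1) (hg'x₀ : g' x₀ = g e)
    (hbeyond : 1 < g' x) : g x - g' x = g e - 1 ∧ g e < g x := by
  -- The coordinate functional of `x₀` is `(g - g') / (1 - g e)`.
  have hpos : 0 < 1 - g e := by linarith
  have happ : ∀ y, ((1 - g e)⁻¹ • (g - g')) y = (1 - g e)⁻¹ * (g y - g' y) := fun y => by simp
  obtain ⟨x', hx'V, hdx', hlt, hfac, -⟩ := hV.exists_neighbor hg hx₀ h₀
    (d := (1 - g e)⁻¹ • (g - g')) (by rw [happ, h₀, hg'x₀, inv_mul_cancel₀ hpos.ne'])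
    (fun y hy h1 h2 => by rw [happ, h1, hridge y hy h1 h2]; simp)
  have hx'diff : g x' - g' x' = g e - 1 := by
    rw [happ, inv_mul_eq_iff_eq_mul₀ hpos.ne'] at hdx'
    linarith
  have hge' : g e ≤ g x' := by
    have := hfac.1 e he
    rw [LinearMap.add_apply, LinearMap.smul_apply, smul_eq_mul, happ, hg'e] at this
    rw [show g e - 1 = -(1 - g e) by ring, mul_neg, inv_mul_cancel₀ hpos.ne'] at this
    linarith
  have hge_ne : g e ≠ g x' := by
    intro h
    have h1 := hfac.1 x hxV
    rw [LinearMap.add_apply, LinearMap.smul_apply, smul_eq_mul, happ, ← h,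
      show g e - 1 = -(1 - g e) by ring, neg_mul, ← mul_assoc, mul_inv_cancel₀ hpos.ne'] at h1
    linarith
  have hx' : x' = x := by
    by_contra hne
    have := hg'V x' hx'V hne
    apply hge_ne
    linarith
  subst hx'
  exact ⟨hx'diff, lt_of_le_of_ne hge' hge_ne⟩

end IsSmoothFanoSet

end FanoPolytope

/-! ### The boundary complex and the linear relations -/

namespace FanoPolytope

/-- Labels for the vertices `v i`, `y q`, `z`, `t`, `u q` and `w j i`. -/
inductive Label (a b k : ℕ) (l : Fin k → ℕ) : Type
  | v (i : Fin a)
  | y (q : Fin b)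
  | z
  | t
  | u (q : Fin b)
  | w (j : Fin k) (i : Fin (l j + 1))

/-- The five kinds of maximal simplices of the boundary complex, each named after the three blocks
of the pentagon `v, y, z, t, u` in which one vertex is left out. -/
inductive Kind : Type
  | vyt
  | yzu
  | ztv
  | tuy
  | uvz

/-- A choice of one label in each of the blocks `v`, `y`, `u` and `w j`. -/
structure Transversal (a b k : ℕ) (l : Fin k → ℕ) : Type where
  /-- the index chosen among the `v i` -/
  i : Fin a
  /-- the index chosen among the `y q` -/
  q : Fin b
  /-- the index chosen among the `u q` -/
  r : Fin b
  /-- the index chosen among the `w j i`, for each `j` -/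
  s : (j : Fin k) → Fin (l j + 1)

/-- The primitive collections: the edges of the pentagon `v, y, z, t, u` and the blocks `w j`. -/
inductive Prim (k : ℕ) : Type
  | vy
  | yz
  | zt
  | tu
  | uv
  | w (j : Fin k)

variable {a b k n : ℕ} {l : Fin k → ℕ}

/-- Membership of a label in a primitive collection. -/
def Prim.Mem : Prim k → Label a b k l → Prop
  | .vy, .v _ | .vy, .y _ => True
  | .yz, .y _ | .yz, .z => True
  | .zt, .z | .zt, .t => True
  | .tu, .t | .tu, .u _ => True
  | .uv, .u _ | .uv, .v _ => True
  | .w j, .w j' _ => j' = j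
  | _, _ => False

/-- The labels left out by the maximal simplex given by a kind and a transversal. -/
def Omits (κ : Kind) (T : Transversal a b k l) : Label a b k l → Prop
  | .v i => (κ = .vyt ∨ κ = .ztv ∨ κ = .uvz) ∧ i = T.i
  | .y q => (κ = .vyt ∨ κ = .yzu ∨ κ = .tuy) ∧ q = T.q
  | .z => κ = .yzu ∨ κ = .ztv ∨ κ = .uvz
  | .t => κ = .vyt ∨ κ = .ztv ∨ κ = .tuy
  | .u r => (κ = .yzu ∨ κ = .tuy ∨ κ = .uvz) ∧ r = T.r
  | .w j i => i = T.s j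

/-- A vertex cover of the pentagon contains two adjacent vertices and the opposite one. -/
lemma pentagon_cover {v y z t u : Prop} (h1 : v ∨ y) (h2 : y ∨ z) (h3 : z ∨ t) (h4 : t ∨ u)
    (h5 : u ∨ v) :
    (v ∧ y ∧ t) ∨ (y ∧ z ∧ u) ∨ (z ∧ t ∧ v) ∨ (t ∧ u ∧ y) ∨ (u ∧ v ∧ z) := by
  by_cases v <;> by_cases y <;> by_cases z <;> by_cases t <;> simp_all

/-- A set of labels that meets all primitive collections contains the complement of a maximal
simplex. -/
lemma exists_omits_of_meets (ha : 0 < a) (hb : 0 < b) (N : Label a b k l → Prop)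
    (hN : ∀ π : Prim k, ∃ x, π.Mem x ∧ N x) : ∃ κ T, ∀ x, Omits κ T x → N x := by
  obtain ⟨i, hi⟩ : ∃ i, (∃ i, N (.v i)) → N (.v i) := by
    by_cases h : ∃ i, N (.v i)
    · exact ⟨h.choose, fun _ => h.choose_spec⟩
    · exact ⟨⟨0, ha⟩, fun h' => absurd h' h⟩
  obtain ⟨q, hq⟩ : ∃ q, (∃ q, N (.y q)) → N (.y q) := by
    by_cases h : ∃ q, N (.y q)
    · exact ⟨h.choose, fun _ => h.choose_spec⟩
    · exact ⟨⟨0, hb⟩, fun h' => absurd h' h⟩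
  obtain ⟨r, hr⟩ : ∃ r, (∃ r, N (.u r)) → N (.u r) := by
    by_cases h : ∃ r, N (.u r)
    · exact ⟨h.choose, fun _ => h.choose_spec⟩
    · exact ⟨⟨0, hb⟩, fun h' => absurd h' h⟩
  have hs : ∀ j, ∃ s, N (.w j s) := by
    intro j
    obtain ⟨x, hx, hNx⟩ := hN (.w j)
    cases x <;> simp only [Prim.Mem] at hx
    subst hx
    exact ⟨_, hNx⟩
  choose s hs using hs
  have h1 : N (.v i) ∨ N (.y q) := by
    obtain ⟨x, hx, hNx⟩ := hN .vy
    cases x <;> simp only [Prim.Mem] at hx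
    exacts [Or.inl (hi ⟨_, hNx⟩), Or.inr (hq ⟨_, hNx⟩)]
  have h2 : N (.y q) ∨ N .z := by
    obtain ⟨x, hx, hNx⟩ := hN .yz
    cases x <;> simp only [Prim.Mem] at hx
    exacts [Or.inl (hq ⟨_, hNx⟩), Or.inr hNx]
  have h3 : N .z ∨ N .t := by
    obtain ⟨x, hx, hNx⟩ := hN .zt
    cases x <;> simp only [Prim.Mem] at hx
    exacts [Or.inl hNx, Or.inr hNx]
  have h4 : N .t ∨ N (.u r) := by
    obtain ⟨x, hx, hNx⟩ := hN .tu
    cases x <;> simp only [Prim.Mem] at hx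
    exacts [Or.inl hNx, Or.inr (hr ⟨_, hNx⟩)]
  have h5 : N (.u r) ∨ N (.v i) := by
    obtain ⟨x, hx, hNx⟩ := hN .uv
    cases x <;> simp only [Prim.Mem] at hx
    exacts [Or.inr (hi ⟨_, hNx⟩), Or.inl (hr ⟨_, hNx⟩)]
  have key : ∃ κ : Kind, ((κ = .vyt ∨ κ = .ztv ∨ κ = .uvz) → N (.v i)) ∧
      ((κ = .vyt ∨ κ = .yzu ∨ κ = .tuy) → N (.y q)) ∧
      ((κ = .yzu ∨ κ = .ztv ∨ κ = .uvz) → N .z) ∧ ((κ = .vyt ∨ κ = .ztv ∨ κ = .tuy) → N .t) ∧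
      ((κ = .yzu ∨ κ = .tuy ∨ κ = .uvz) → N (.u r)) := by
    have : (N (.v i) ∧ N (.y q) ∧ N .t) ∨ (N (.y q) ∧ N .z ∧ N (.u r)) ∨
        (N .z ∧ N .t ∧ N (.v i)) ∨ (N .t ∧ N (.u r) ∧ N (.y q)) ∨
        (N (.u r) ∧ N (.v i) ∧ N .z) := pentagon_cover h1 h2 h3 h4 h5
    rcases this with h | h | h | h | h
    · exact ⟨.vyt, by simp [h]⟩
    · exact ⟨.yzu, by simp [h]⟩
    · exact ⟨.ztv, by simp [h]⟩
    · exact ⟨.tuy, by simp [h]⟩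
    · exact ⟨.uvz, by simp [h]⟩
  obtain ⟨κ, k1, k2, k3, k4, k5⟩ := key
  refine ⟨κ, ⟨i, q, r, s⟩, ?_⟩
  rintro (i' | q' | _ | _ | r' | ⟨j, i'⟩) hx <;> simp only [Omits] at hx
  · rw [hx.2]
    exact k1 hx.1
  · rw [hx.2]
    exact k2 hx.1
  · exact k3 hx
  · exact k4 hx
  · rw [hx.2]
    exact k5 hx.1
  · rw [hx]
    exact hs j

/-- Any two labels are separated by a maximal simplex. -/
lemma exists_omits_separating (ha : 2 ≤ a) (hb : 1 ≤ b) (hl : ∀ j, 1 ≤ l j)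
    {x x' : Label a b k l} (hne : x ≠ x') : ∃ κ T, ¬ Omits κ T x ∧ Omits κ T x' := by
  let T₀ : Transversal a b k l := ⟨⟨0, by omega⟩, ⟨0, hb⟩, ⟨0, hb⟩, fun _ => 0⟩
  -- For `x` in a block `w j`, the transversal has to avoid `x`.
  obtain ⟨s₀, hs₀⟩ : ∃ s₀ : (j : Fin k) → Fin (l j + 1), ∀ j i, x = .w j i → i ≠ s₀ j := by
    rcases x with i | q | _ | _ | r | ⟨j, i⟩
    iterate 5 exact ⟨fun _ => 0, by simp⟩
    have : Nontrivial (Fin (l j + 1)) := Fin.nontrivial_iff_two_le.2 (by have := hl j; omega)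
    obtain ⟨m, hm⟩ := exists_ne i
    refine ⟨Function.update (fun _ => 0) j m, ?_⟩
    rintro j' i' h
    injection h with h1 h2
    subst h1
    rw [← eq_of_heq h2, Function.update_self]
    exact hm.symm
  rcases x' with i' | q' | _ | _ | r' | ⟨j', i'⟩
  · rcases x with i | q | _ | _ | r | ⟨j, i⟩
    · exact ⟨.ztv, { T₀ with i := i' }, by simpa [Omits] using hne, by simp [Omits]⟩
    · exact ⟨.ztv, { T₀ with i := i' }, by simp [Omits], by simp [Omits]⟩
    · exact ⟨.vyt, { T₀ with i := i' }, by simp [Omits], by simp [Omits]⟩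
    · exact ⟨.uvz, { T₀ with i := i' }, by simp [Omits], by simp [Omits]⟩
    · exact ⟨.ztv, { T₀ with i := i' }, by simp [Omits], by simp [Omits]⟩
    · exact ⟨.ztv, { T₀ with i := i', s := s₀ }, by simpa [Omits] using hs₀ _ _ rfl,
        by simp [Omits]⟩
  · rcases x with i | q | _ | _ | r | ⟨j, i⟩
    · exact ⟨.yzu, { T₀ with q := q' }, by simp [Omits], by simp [Omits]⟩
    · exact ⟨.yzu, { T₀ with q := q' }, by simpa [Omits] using hne, by simp [Omits]⟩
    · exact ⟨.vyt, { T₀ with q := q' }, by simp [Omits], by simp [Omits]⟩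
    · exact ⟨.yzu, { T₀ with q := q' }, by simp [Omits], by simp [Omits]⟩
    · exact ⟨.vyt, { T₀ with q := q' }, by simp [Omits], by simp [Omits]⟩
    · exact ⟨.yzu, { T₀ with q := q', s := s₀ }, by simpa [Omits] using hs₀ _ _ rfl,
        by simp [Omits]⟩
  · rcases x with i | q | _ | _ | r | ⟨j, i⟩
    · exact ⟨.yzu, T₀, by simp [Omits], by simp [Omits]⟩
    · exact ⟨.ztv, T₀, by simp [Omits], by simp [Omits]⟩
    · exact absurd rfl hne
    · exact ⟨.yzu, T₀, by simp [Omits], by simp [Omits]⟩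
    · exact ⟨.ztv, T₀, by simp [Omits], by simp [Omits]⟩
    · exact ⟨.yzu, { T₀ with s := s₀ }, by simpa [Omits] using hs₀ _ _ rfl, by simp [Omits]⟩
  · rcases x with i | q | _ | _ | r | ⟨j, i⟩
    · exact ⟨.tuy, T₀, by simp [Omits], by simp [Omits]⟩
    · exact ⟨.ztv, T₀, by simp [Omits], by simp [Omits]⟩
    · exact ⟨.vyt, T₀, by simp [Omits], by simp [Omits]⟩
    · exact absurd rfl hne
    · exact ⟨.ztv, T₀, by simp [Omits], by simp [Omits]⟩
    · exact ⟨.tuy, { T₀ with s := s₀ }, by simpa [Omits] using hs₀ _ _ rfl, by simp [Omits]⟩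
  · rcases x with i | q | _ | _ | r | ⟨j, i⟩
    · exact ⟨.tuy, { T₀ with r := r' }, by simp [Omits], by simp [Omits]⟩
    · exact ⟨.uvz, { T₀ with r := r' }, by simp [Omits], by simp [Omits]⟩
    · exact ⟨.tuy, { T₀ with r := r' }, by simp [Omits], by simp [Omits]⟩
    · exact ⟨.yzu, { T₀ with r := r' }, by simp [Omits], by simp [Omits]⟩
    · exact ⟨.yzu, { T₀ with r := r' }, by simpa [Omits] using hne, by simp [Omits]⟩
    · exact ⟨.tuy, { T₀ with r := r', s := s₀ }, by simpa [Omits] using hs₀ _ _ rfl,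
        by simp [Omits]⟩
  · rcases x with i | q | _ | _ | r | ⟨j, i⟩
    · exact ⟨.tuy, { T₀ with s := Function.update s₀ j' i' }, by simp [Omits], by simp [Omits]⟩
    · exact ⟨.ztv, { T₀ with s := Function.update s₀ j' i' }, by simp [Omits], by simp [Omits]⟩
    · exact ⟨.tuy, { T₀ with s := Function.update s₀ j' i' }, by simp [Omits], by simp [Omits]⟩
    · exact ⟨.yzu, { T₀ with s := Function.update s₀ j' i' }, by simp [Omits], by simp [Omits]⟩
    · exact ⟨.ztv, { T₀ with s := Function.update s₀ j' i' }, by simp [Omits], by simp [Omits]⟩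
    · refine ⟨.tuy, { T₀ with s := Function.update s₀ j' i' }, ?_, by simp [Omits]⟩
      rcases eq_or_ne j j' with rfl | hj
      · simpa [Omits] using hne
      · simpa [Omits, hj] using hs₀ _ _ rfl

/-- The label of the summand `α j i`. -/
def summand (α : (j : Fin k) → Fin (l j) → Fin b ⊕ Fin b) (j : Fin k) (i : Fin (l j)) :
    Label a b k l :=
  Sum.elim .y .u (α j i)

/-- The linear relations between the vertices. The remaining primitive relations
`t + ∑ u = ∑ y` and `∑ u + ∑ v = (a + b - 2) t` follow from these. The coefficient `a + b - 1` is
avoided by adding `t` to both sides. -/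
structure IsRel (α : (j : Fin k) → Fin (l j) → Fin b ⊕ Fin b) {M : Type*} [AddCommGroup M]
    (h : Label a b k l → M) : Prop where
  vy : ∑ i, h (.v i) + ∑ q, h (.y q) + h .t = (a + b) • h .t
  yz : ∑ q, h (.y q) + h .z = ∑ q, h (.u q)
  zt : h .z + h .t = 0
  w : ∀ j, ∑ i, h (.w j i) = ∑ i, h (summand α j i)

variable {α : (j : Fin k) → Fin (l j) → Fin b ⊕ Fin b} {M N : Type*} [AddCommGroup M]
  [AddCommGroup N]

lemma IsRel.map {h : Label a b k l → M} (hh : IsRel α h) (f : M →+ N) :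
    IsRel α (fun x => f (h x)) where
  vy := by simpa using congrArg f hh.vy
  yz := by simpa using congrArg f hh.yz
  zt := by simpa using congrArg f hh.zt
  w := fun j => by simpa using congrArg f (hh.w j)

lemma IsRel.sub {h h' : Label a b k l → M} (hh : IsRel α h) (hh' : IsRel α h') :
    IsRel α (fun x => h x - h' x) where
  vy := by
    have h1 := hh.vy
    have h2 := hh'.vy
    simp only [Finset.sum_sub_distrib, smul_sub]
    rw [← h1, ← h2]
    abel
  yz := by
    simp only [Finset.sum_sub_distrib, ← hh.yz, ← hh'.yz]
    abel
  zt := by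
    have := congrArg₂ (· - ·) hh.zt hh'.zt
    simp only [sub_zero] at this
    rw [← this]
    abel
  w := fun j => by simp only [Finset.sum_sub_distrib, hh.w, hh'.w]

lemma eq_zero_of_sum_eq_zero {ι : Type*} [Fintype ι] (f : ι → M) (i₀ : ι)
    (h : ∀ i, i ≠ i₀ → f i = 0) (hsum : ∑ i, f i = 0) (i : ι) : f i = 0 := by
  rcases eq_or_ne i i₀ with rfl | hi
  · rwa [Fintype.sum_eq_single i h] at hsum
  · exact h i hi

/-- A family satisfying the relations is determined by its values on a maximal simplex. This holds
in any abelian group, so that maximal simplices span over `ℝ` as well as over `ℤ`. -/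
lemma IsRel.eq_zero {h : Label a b k l → M} (hh : IsRel α h) (κ : Kind) (T : Transversal a b k l)
    (h0 : ∀ x, ¬ Omits κ T x → h x = 0) (x : Label a b k l) : h x = 0 := by
  have key : h .z = 0 ∧ h .t = 0 ∧ ∑ i, h (.v i) = 0 ∧ ∑ q, h (.y q) = 0 ∧ ∑ q, h (.u q) = 0 := by
    have e1 := hh.vy
    have e2 := hh.yz
    have e3 := hh.zt
    have hv : (¬ (κ = .vyt ∨ κ = .ztv ∨ κ = .uvz)) → ∑ i, h (.v i) = 0 := fun hκ =>
      Finset.sum_eq_zero fun i _ => h0 _ (fun ho => hκ ho.1)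
    have hy : (¬ (κ = .vyt ∨ κ = .yzu ∨ κ = .tuy)) → ∑ i, h (.y i) = 0 := fun hκ =>
      Finset.sum_eq_zero fun i _ => h0 _ (fun ho => hκ ho.1)
    have hu : (¬ (κ = .yzu ∨ κ = .tuy ∨ κ = .uvz)) → ∑ i, h (.u i) = 0 := fun hκ =>
      Finset.sum_eq_zero fun i _ => h0 _ (fun ho => hκ ho.1)
    have hz : (¬ (κ = .yzu ∨ κ = .ztv ∨ κ = .uvz)) → h .z = 0 := fun hκ => h0 _ hκ
    have ht : (¬ (κ = .vyt ∨ κ = .ztv ∨ κ = .tuy)) → h .t = 0 := fun hκ => h0 _ hκ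
    cases κ <;> simp_all
  obtain ⟨hz, ht, hv, hy, hu⟩ := key
  have hv' := eq_zero_of_sum_eq_zero (fun i => h (.v i)) T.i
    (fun i hi => h0 _ fun ho => hi ho.2) hv
  have hy' := eq_zero_of_sum_eq_zero (fun i => h (.y i)) T.q
    (fun i hi => h0 _ fun ho => hi ho.2) hy
  have hu' := eq_zero_of_sum_eq_zero (fun i => h (.u i)) T.r
    (fun i hi => h0 _ fun ho => hi ho.2) hu
  rcases x with i | q | _ | _ | r | ⟨j, i⟩
  · exact hv' i
  · exact hy' q
  · exact hz
  · exact ht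
  · exact hu' r
  · refine eq_zero_of_sum_eq_zero (fun i => h (.w j i)) (T.s j) (fun i hi => h0 _ hi) ?_ i
    rw [hh.w j]
    refine Finset.sum_eq_zero fun m _ => ?_
    rw [summand]
    cases α j m
    · exact hy' _
    · exact hu' _

/-- No primitive collection lies on a supporting hyperplane: this is where the degrees of the
primitive relations, which are positive, come in. -/
lemma IsRel.exists_lt_one (ha : 2 ≤ a) (hb : 1 ≤ b) {h : Label a b k l → ℝ} (hh : IsRel α h)
    (hle : ∀ x, h x ≤ 1) (π : Prim k) : ∃ x, π.Mem x ∧ h x < 1 := by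
  by_contra! hcon
  have h1 : ∀ x, π.Mem x → h x = 1 := fun x hx => le_antisymm (hle x) (hcon x hx)
  have e1 := hh.vy
  have e2 := hh.yz
  have e3 := hh.zt
  rw [nsmul_eq_mul] at e1
  push_cast at e1
  have haR : (2 : ℝ) ≤ a := by exact_mod_cast ha
  have hbR : (1 : ℝ) ≤ b := by exact_mod_cast hb
  have hSy : ∑ q, h (.y q) ≤ b := by
    simpa using Finset.sum_le_sum (s := Finset.univ) fun q _ => hle (.y q)
  have hSu : ∑ q, h (.u q) ≤ b := by
    simpa using Finset.sum_le_sum (s := Finset.univ) fun q _ => hle (.u q)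
  have ht := hle .t
  have hz := hle .z
  cases π with
  | vy =>
    have hv : ∑ i, h (.v i) = a := by simp [h1 (.v _) trivial]
    have hy : ∑ q, h (.y q) = b := by simp [h1 (.y _) trivial]
    rw [hv, hy] at e1
    nlinarith
  | yz =>
    have hy : ∑ q, h (.y q) = b := by simp [h1 (.y _) trivial]
    have := h1 .z trivial
    linarith
  | zt =>
    have := h1 .z trivial
    have := h1 .t trivial
    linarith
  | tu =>
    have hu : ∑ q, h (.u q) = b := by simp [h1 (.u _) trivial]
    have := h1 .t trivial
    linarith
  | uv =>
    have hv : ∑ i, h (.v i) = a := by simp [h1 (.v _) trivial]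
    have hu : ∑ q, h (.u q) = b := by simp [h1 (.u _) trivial]
    rw [hv] at e1
    nlinarith
  | w j =>
    have hw : ∑ i, h (.w j i) = l j + 1 := by simp [h1 (.w j _) rfl]
    have : ∑ i, h (summand α j i) ≤ l j := by
      simpa using Finset.sum_le_sum (s := Finset.univ) fun i _ => hle (summand α j i)
    rw [← hh.w j] at this
    linarith

/-- The value of `1 - g` at the vertex left out in the block `v`, for the functional `g` that
defines the facet of the given kind. -/
def Kind.defectV (a b : ℕ) : Kind → ℝ
  | .vyt => 2 * (a + b - 1)
  | .ztv => a + b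
  | .uvz => 1
  | _ => 0

/-- The counterpart of `Kind.defectV` for the block `y`. -/
def Kind.defectY (a b : ℕ) : Kind → ℝ
  | .vyt => 1
  | .yzu => 1
  | .tuy => 2 * (a + b) - 1
  | _ => 0

/-- The counterpart of `Kind.defectV` for `z`. -/
def Kind.defectZ : Kind → ℝ
  | .yzu => 2
  | .ztv => 1
  | .uvz => 2
  | _ => 0

/-- The counterpart of `Kind.defectV` for `t`. -/
def Kind.defectT : Kind → ℝ
  | .vyt => 2
  | .ztv => 1
  | .tuy => 2
  | _ => 0

/-- The counterpart of `Kind.defectV` for the block `u`. -/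
def Kind.defectU (a b : ℕ) : Kind → ℝ
  | .yzu => 2
  | .tuy => 2 * (a + b) - 2
  | .uvz => 1
  | _ => 0

open Classical in
/-- The contribution `1 - g` of a summand `y q` or `u q`. -/
noncomputable def summandDefect (a : ℕ) (κ : Kind) (q r : Fin b) : Fin b ⊕ Fin b → ℝ
  | .inl q' => if q' = q then κ.defectY a b else 0
  | .inr r' => if r' = r then κ.defectU a b else 0

open Classical in
/-- The values on the vertices of the functional that defines a facet. -/
noncomputable def facetVal (α : (j : Fin k) → Fin (l j) → Fin b ⊕ Fin b) (κ : Kind)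
    (T : Transversal a b k l) : Label a b k l → ℝ
  | .v i => 1 - if i = T.i then κ.defectV a b else 0
  | .y q => 1 - if q = T.q then κ.defectY a b else 0
  | .z => 1 - κ.defectZ
  | .t => 1 - κ.defectT
  | .u r => 1 - if r = T.r then κ.defectU a b else 0
  | .w j i => 1 - if i = T.s j then 1 + ∑ m, summandDefect a κ T.q T.r (α j m) else 0

lemma facetVal_summand (κ : Kind) (T : Transversal a b k l) (j : Fin k) (i : Fin (l j)) :
    facetVal α κ T (summand α j i) = 1 - summandDefect a κ T.q T.r (α j i) := by
  rw [summand]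
  cases α j i <;> simp [facetVal, summandDefect]

lemma isRel_facetVal (α : (j : Fin k) → Fin (l j) → Fin b ⊕ Fin b) (κ : Kind)
    (T : Transversal a b k l) : IsRel α (facetVal α κ T) where
  vy := by
    simp only [facetVal, Finset.sum_sub_distrib, Finset.sum_ite_eq', Finset.sum_const,
      Finset.card_univ, Fintype.card_fin, Finset.mem_univ, if_true, nsmul_eq_mul, mul_one]
    push_cast
    cases κ <;> simp only [Kind.defectV, Kind.defectY, Kind.defectT] <;> ring
  yz := by
    simp only [facetVal, Finset.sum_sub_distrib, Finset.sum_ite_eq', Finset.sum_const,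
      Finset.card_univ, Fintype.card_fin, Finset.mem_univ, if_true, nsmul_eq_mul, mul_one]
    cases κ <;> simp only [Kind.defectU, Kind.defectY, Kind.defectZ] <;> ring
  zt := by
    simp only [facetVal]
    cases κ <;> simp only [Kind.defectT, Kind.defectZ] <;> ring
  w := fun j => by
    simp only [facetVal_summand]
    simp only [facetVal, Finset.sum_sub_distrib, Finset.sum_ite_eq', Finset.sum_const,
      Finset.card_univ, Fintype.card_fin, Finset.mem_univ, if_true, nsmul_eq_mul, mul_one]
    push_cast
    ring

lemma summandDefect_nonneg (ha : 2 ≤ a) (κ : Kind) (q r : Fin b) (s : Fin b ⊕ Fin b) :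
    0 ≤ summandDefect a κ q r s := by
  have haR : (2 : ℝ) ≤ a := by exact_mod_cast ha
  have hbR : (0 : ℝ) ≤ b := Nat.cast_nonneg b
  rcases s with q' | r' <;> simp only [summandDefect] <;> split_ifs <;> try exact le_rfl
  · cases κ <;> simp only [Kind.defectY] <;> linarith
  · cases κ <;> simp only [Kind.defectU] <;> linarith

lemma facetVal_eq_one {κ : Kind} {T : Transversal a b k l} {x : Label a b k l}
    (hx : ¬ Omits κ T x) : facetVal α κ T x = 1 := by
  rcases x with i | q | _ | _ | r | ⟨j, i⟩ <;> simp only [Omits] at hx <;>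
    simp only [facetVal, sub_eq_self, ite_eq_right_iff]
  · intro hi
    cases κ <;> simp_all [Kind.defectV]
  · intro hi
    cases κ <;> simp_all [Kind.defectY]
  · cases κ <;> simp_all [Kind.defectZ]
  · cases κ <;> simp_all [Kind.defectT]
  · intro hi
    cases κ <;> simp_all [Kind.defectU]
  · exact fun hi => absurd hi hx

lemma facetVal_le_zero (ha : 2 ≤ a) (hb : 1 ≤ b) {κ : Kind} {T : Transversal a b k l}
    {x : Label a b k l} (hx : Omits κ T x) : facetVal α κ T x ≤ 0 := by
  have haR : (2 : ℝ) ≤ a := by exact_mod_cast ha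
  have hbR : (1 : ℝ) ≤ b := by exact_mod_cast hb
  rcases x with i | q | _ | _ | r | ⟨j, i⟩ <;> simp only [Omits] at hx <;> simp only [facetVal]
  · rw [if_pos hx.2]
    cases κ <;> simp at hx <;> simp only [Kind.defectV] <;> linarith
  · rw [if_pos hx.2]
    cases κ <;> simp at hx <;> simp only [Kind.defectY] <;> linarith
  · cases κ <;> simp at hx <;> simp only [Kind.defectZ] <;> linarith
  · cases κ <;> simp at hx <;> simp only [Kind.defectT] <;> linarith
  · rw [if_pos hx.2]
    cases κ <;> simp at hx <;> simp only [Kind.defectU] <;> linarith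
  · rw [if_pos hx]
    have := Finset.sum_nonneg fun m (_ : m ∈ Finset.univ) =>
      summandDefect_nonneg ha κ T.q T.r (α j m)
    linarith

lemma facetVal_eq_one_iff (ha : 2 ≤ a) (hb : 1 ≤ b) {κ : Kind} {T : Transversal a b k l}
    {x : Label a b k l} : facetVal α κ T x = 1 ↔ ¬ Omits κ T x :=
  ⟨fun h ho => by linarith [facetVal_le_zero (α := α) ha hb ho], facetVal_eq_one⟩

lemma facetVal_le_one (ha : 2 ≤ a) (hb : 1 ≤ b) (κ : Kind) (T : Transversal a b k l)
    (x : Label a b k l) : facetVal α κ T x ≤ 1 := by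
  by_cases hx : Omits κ T x
  · linarith [facetVal_le_zero (α := α) ha hb hx]
  · exact (facetVal_eq_one hx).le

end FanoPolytope

/-! ### No vertex can be removed -/

namespace FanoPolytope

variable {a b k n : ℕ} {l : Fin k → ℕ} {α : (j : Fin k) → Fin (l j) → Fin b ⊕ Fin b}

/-- A realization of the labels by lattice points in `ℝ ^ n` for which the relations `IsRel` are
satisfied, and generate all linear relations. The latter condition is stated dually. -/
structure IsConfig (α : (j : Fin k) → Fin (l j) → Fin b ⊕ Fin b)
    (p : Label a b k l → Fin n → ℝ) : Prop where
  rel : IsRel α p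
  ext : ∀ h : Label a b k l → ℝ, IsRel α h → ∃ g : (Fin n → ℝ) →ₗ[ℝ] ℝ, ∀ x, g (p x) = h x
  span : Submodule.span ℝ (Set.range p) = ⊤
  mem_lattice : ∀ x, p x ∈ intLattice n

namespace IsConfig

variable {p : Label a b k l → Fin n → ℝ}

/-- The functional with the values `facetVal` on the vertices. -/
noncomputable def fn (hp : IsConfig α p) (κ : Kind) (T : Transversal a b k l) :
    (Fin n → ℝ) →ₗ[ℝ] ℝ :=
  (hp.ext _ (isRel_facetVal α κ T)).choose

lemma fn_apply (hp : IsConfig α p) (κ : Kind) (T : Transversal a b k l) (x : Label a b k l) :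
    hp.fn κ T (p x) = facetVal α κ T x :=
  (hp.ext _ (isRel_facetVal α κ T)).choose_spec x

lemma span_simplex (hp : IsConfig α p) (κ : Kind) (T : Transversal a b k l) :
    Submodule.span ℝ (p '' {x | ¬ Omits κ T x}) = ⊤ := by
  have := (hp.rel.map (Submodule.mkQ (Submodule.span ℝ
    (p '' {x | ¬ Omits κ T x}))).toAddMonoidHom).eq_zero κ T (fun x hx => by
      simpa using Submodule.subset_span (Set.mem_image_of_mem p hx))
  rw [eq_top_iff, ← hp.span, Submodule.span_le]
  rintro _ ⟨x, rfl⟩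
  simpa using this x

lemma rel_comp (hp : IsConfig α p) (g : (Fin n → ℝ) →ₗ[ℝ] ℝ) : IsRel α (fun x => g (p x)) :=
  hp.rel.map g.toAddMonoidHom

lemma eq_fn (hp : IsConfig α p) {g : (Fin n → ℝ) →ₗ[ℝ] ℝ} {κ : Kind} {T : Transversal a b k l}
    (h : ∀ x, ¬ Omits κ T x → g (p x) = 1) : g = hp.fn κ T := by
  refine LinearMap.ext_on (hp.span_simplex κ T) ?_
  rintro _ ⟨x, hx, rfl⟩
  rw [h x hx, hp.fn_apply, facetVal_eq_one hx]

lemma isFacetFn (hp : IsConfig α p) {W : Set (Fin n → ℝ)} {κ : Kind} {T : Transversal a b k l}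
    (hW : ∀ y ∈ W, hp.fn κ T y ≤ 1) (hmem : ∀ x, ¬ Omits κ T x → p x ∈ W) :
    IsFacetFn W (hp.fn κ T) := by
  refine ⟨hW, ?_⟩
  rw [eq_top_iff, ← hp.span_simplex κ T]
  refine Submodule.span_mono ?_
  rintro _ ⟨x, hx, rfl⟩
  exact ⟨hmem x hx, by rw [hp.fn_apply, facetVal_eq_one hx]⟩

lemma fn_le_one (ha : 2 ≤ a) (hb : 1 ≤ b) (hp : IsConfig α p) (κ : Kind)
    (T : Transversal a b k l) {y : Fin n → ℝ} (hy : y ∈ Set.range p) : hp.fn κ T y ≤ 1 := by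
  obtain ⟨x, rfl⟩ := hy
  rw [hp.fn_apply]
  exact facetVal_le_one ha hb κ T x

lemma isFacetFn_range (ha : 2 ≤ a) (hb : 1 ≤ b) (hp : IsConfig α p) (κ : Kind)
    (T : Transversal a b k l) : IsFacetFn (Set.range p) (hp.fn κ T) :=
  hp.isFacetFn (fun _ hy => hp.fn_le_one ha hb κ T hy) (fun x _ => ⟨x, rfl⟩)

lemma injective (ha : 2 ≤ a) (hb : 1 ≤ b) (hl : ∀ j, 1 ≤ l j) (hp : IsConfig α p) :
    Function.Injective p := by
  intro x x' h
  by_contra hne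
  obtain ⟨κ, T, h1, h2⟩ := exists_omits_separating ha hb hl hne
  have := facetVal_le_zero (α := α) ha hb h2
  rw [← hp.fn_apply, ← h, hp.fn_apply, facetVal_eq_one h1] at this
  linarith

/-- A functional that is at most `1` on the vertices attains `1` on a simplex only. -/
lemma exists_simplex (ha : 2 ≤ a) (hb : 1 ≤ b) (hp : IsConfig α p) {g : (Fin n → ℝ) →ₗ[ℝ] ℝ}
    (hg : ∀ x, g (p x) ≤ 1) : ∃ κ T, ∀ x, g (p x) = 1 → ¬ Omits κ T x := by
  obtain ⟨κ, T, h⟩ := exists_omits_of_meets (by omega) (by omega) (fun x => g (p x) < 1)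
    (fun π => (hp.rel_comp g).exists_lt_one ha hb hg π)
  exact ⟨κ, T, fun x hx ho => (h x ho).ne hx⟩

/-- The facet functionals of the configuration are those of the list. -/
lemma exists_eq_fn (ha : 2 ≤ a) (hb : 1 ≤ b) (hp : IsConfig α p)
    {g : (Fin n → ℝ) →ₗ[ℝ] ℝ} (hg : IsFacetFn (Set.range p) g) : ∃ κ T, g = hp.fn κ T := by
  obtain ⟨κ, T, h⟩ := hp.exists_simplex ha hb (fun x => hg.1 _ ⟨x, rfl⟩)
  refine ⟨κ, T, IsSmoothFanoSet.functional_ext hg ?_⟩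
  rintro _ ⟨x, rfl⟩ h1
  rw [h1, hp.fn_apply, facetVal_eq_one (h x h1)]

end IsConfig

lemma sum_eq_card_add {ι : Type*} [Fintype ι] (f : ι → ℝ) (i₀ : ι)
    (h : ∀ i, i ≠ i₀ → f i = 1) : ∑ i, f i = Fintype.card ι + (f i₀ - 1) := by
  have := Fintype.sum_eq_single (f := fun i => f i - 1) i₀ (fun i hi => by simp [h i hi])
  rw [Finset.sum_sub_distrib] at this
  simp at this
  linarith

lemma sum_eq_card {ι : Type*} [Fintype ι] (f : ι → ℝ) (h : ∀ i, f i = 1) :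
    ∑ i, f i = Fintype.card ι := by
  simp [h]

lemma sum_le_card {ι : Type*} [Fintype ι] (f : ι → ℝ) (h : ∀ i, f i ≤ 1) :
    ∑ i, f i ≤ Fintype.card ι := by
  simpa using Finset.sum_le_sum (s := Finset.univ) fun i _ => h i

namespace IsConfig

variable {p : Label a b k l → Fin n → ℝ}

/-- If the vertex `x` can be removed, then a facet of the configuration that does not contain `x`
has a neighbour across the ridge opposite to `x₀` in the remaining polytope. The values of its
functional on the vertices are recorded; `x` itself may get a value greater than `1`. -/
lemma exists_cross (ha : 2 ≤ a) (hb : 1 ≤ b) (hl : ∀ j, 1 ≤ l j) (hp : IsConfig α p)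
    {x x₀ : Label a b k l} (hW : IsSmoothFanoSet (Set.range p \ {p x})) {κ : Kind}
    {T : Transversal a b k l} (hx : Omits κ T x) (hx₀ : ¬ Omits κ T x₀) :
    ∃ h : Label a b k l → ℝ, IsRel α h ∧ (∀ y, y ≠ x → h y ≤ 1) ∧ (∀ y, ∃ m : ℤ, h y = m) ∧
      (∀ y, ¬ Omits κ T y → y ≠ x₀ → h y = 1) ∧
      ∃ e, e ≠ x ∧ Omits κ T e ∧ h e = 1 ∧ ∀ y, y ≠ x → y ≠ e → Omits κ T y → h y < 1 := by
  have hinj := hp.injective ha hb hl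
  have hmem : ∀ y, y ≠ x → p y ∈ Set.range p \ {p x} := fun y hy =>
    ⟨⟨y, rfl⟩, fun h => hy (hinj h)⟩
  have hg : IsFacetFn (Set.range p \ {p x}) (hp.fn κ T) :=
    hp.isFacetFn (fun _ hy => hp.fn_le_one ha hb κ T hy.1)
      (fun y hy => hmem y (fun h => hy (h ▸ hx)))
  have hx₀V := hmem x₀ (fun h => hx₀ (h ▸ hx))
  have h₀ : hp.fn κ T (p x₀) = 1 := by rw [hp.fn_apply, facetVal_eq_one hx₀]
  obtain ⟨d, hd₀, hd⟩ := hW.exists_dual hg hx₀V h₀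
  obtain ⟨x', ⟨⟨e, rfl⟩, hex⟩, -, hlt, hfac, hset⟩ := hW.exists_neighbor hg hx₀V h₀ hd₀ hd
  have hex' : e ≠ x := fun h => hex (by rw [h]; rfl)
  refine ⟨_, hp.rel_comp _, fun y hy => hfac.1 _ (hmem y hy),
    fun y => hW.exists_int hfac (hp.mem_lattice y), ?_, e, hex', ?_, ?_, ?_⟩
  · intro y hy hne
    have hyx : y ≠ x := fun h => hy (h ▸ hx)
    refine (hset _ (hmem y hyx)).2 (Or.inr ⟨?_, fun h => hne (hinj h)⟩)
    rw [hp.fn_apply, facetVal_eq_one hy]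
  · by_contra ho
    rw [hp.fn_apply, facetVal_eq_one ho] at hlt
    exact lt_irrefl _ hlt
  · exact (hset _ (hmem e hex')).2 (Or.inl rfl)
  · intro y hyx hye hy
    refine lt_of_le_of_ne (hfac.1 _ (hmem y hyx)) fun h => ?_
    rcases (hset _ (hmem y hyx)).1 h with h' | ⟨h', -⟩
    · exact hye (hinj h')
    · rw [hp.fn_apply] at h'
      exact (facetVal_eq_one_iff ha hb).1 h' hy

/-- A vertex cannot be removed if some functional is negative on it and nonnegative on the other
vertices, since the origin would not be an interior point any more. -/
lemma not_removable_of_fn (ha : 2 ≤ a) (hb : 1 ≤ b) (hp : IsConfig α p) {x : Label a b k l}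
    {κ κ' : Kind} {T T' : Transversal a b k l} (hx : Omits κ T x) (hx' : ¬ Omits κ' T' x)
    (h : ∀ y, y ≠ x → facetVal α κ' T' y ≤ facetVal α κ T y) :
    ¬ IsSmoothFanoSet (Set.range p \ {p x}) := by
  intro hW
  have := hW.eq_zero_of_nonneg (hp.fn κ T - hp.fn κ' T') (by
    rintro _ ⟨⟨y, rfl⟩, hy⟩
    have hyx : y ≠ x := fun h => hy (by rw [h]; rfl)
    simpa [hp.fn_apply] using h y hyx)
  have h1 := LinearMap.congr_fun this (p x)
  simp only [LinearMap.sub_apply, hp.fn_apply, LinearMap.zero_apply] at h1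
  rw [facetVal_eq_one hx'] at h1
  linarith [facetVal_le_zero (α := α) ha hb hx]

end IsConfig

lemma IsRel.false_of_summand_eq_two {h : Label a b k l → ℝ} (hh : IsRel α h) {x : Label a b k l}
    {j : Fin k} {m : Fin (l j)} (hm : summand α j m = x) (hx : h x = 2)
    (h1 : ∀ j m, summand α j m ≠ x → h (summand α j m) = 1) {i₀ : Fin (l j + 1)}
    (hw : ∀ i, i ≠ i₀ → h (.w j i) = 1) (hi₀ : h (.w j i₀) < 1) : False := by
  have e := hh.w j
  rw [sum_eq_card_add _ i₀ hw] at e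
  have : ∑ i, (1 + if i = m then (1 : ℝ) else 0) ≤ ∑ i, h (summand α j i) := by
    refine Finset.sum_le_sum fun i _ => ?_
    by_cases hi : summand α j i = x
    · rw [hi, hx]
      split_ifs <;> norm_num
    · have him : i ≠ m := fun h' => hi (h' ▸ hm)
      rw [h1 j i hi, if_neg him]
      norm_num
  rw [Finset.sum_add_distrib] at this
  simp at this e
  linarith

lemma IsRel.false_of_summand_le_one {h : Label a b k l → ℝ} (hh : IsRel α h) {j : Fin k}
    (h1 : ∀ m, h (summand α j m) ≤ 1) (hw : ∀ i, h (.w j i) = 1) : False := by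
  have e := hh.w j
  have := sum_le_card _ h1
  rw [sum_eq_card _ hw] at e
  simp at this e
  linarith

lemma le_one_of_lt_two {r : ℝ} (hr : ∃ m : ℤ, r = m) (h : r < 2) : r ≤ 1 := by
  obtain ⟨m, rfl⟩ := hr
  have : m < 2 := by exact_mod_cast h
  exact_mod_cast (by omega : m ≤ 1)

namespace IsConfig

variable {p : Label a b k l → Fin n → ℝ}

/-- Removing one of at least two vertices `v i`, or of at least two vertices of a block `w j`, is
excluded by the functional that takes the values `-1` and `1` on two of them and vanishes on all
other vertices. -/
lemma not_removable_v (ha : 2 ≤ a) (hb : 1 ≤ b) (hp : IsConfig α p) (i : Fin a) :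
    ¬ IsSmoothFanoSet (Set.range p \ {p (.v i)}) := by
  have : Nontrivial (Fin a) := Fin.nontrivial_iff_two_le.2 ha
  obtain ⟨i', hi'⟩ := exists_ne i
  refine hp.not_removable_of_fn ha hb (κ := .uvz) (κ' := .uvz)
    (T := ⟨i, ⟨0, hb⟩, ⟨0, hb⟩, fun _ => 0⟩) (T' := ⟨i', ⟨0, hb⟩, ⟨0, hb⟩, fun _ => 0⟩)
    (by simp [Omits]) (by simpa [Omits] using hi'.symm) ?_
  rintro (i'' | q | _ | _ | r | ⟨j, m⟩) hne <;> simp only [facetVal] <;> try exact le_rfl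
  have : i'' ≠ i := fun h => hne (h ▸ rfl)
  rw [if_neg this]
  split_ifs <;> simp [Kind.defectV]

lemma not_removable_w (ha : 2 ≤ a) (hb : 1 ≤ b) (hl : ∀ j, 1 ≤ l j) (hp : IsConfig α p)
    (j : Fin k) (i : Fin (l j + 1)) : ¬ IsSmoothFanoSet (Set.range p \ {p (.w j i)}) := by
  have : Nontrivial (Fin (l j + 1)) := Fin.nontrivial_iff_two_le.2 (by have := hl j; omega)
  obtain ⟨i', hi'⟩ := exists_ne i
  refine hp.not_removable_of_fn ha hb (κ := .ztv) (κ' := .ztv)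
    (T := ⟨⟨0, by omega⟩, ⟨0, hb⟩, ⟨0, hb⟩, Function.update (fun _ => 0) j i⟩)
    (T' := ⟨⟨0, by omega⟩, ⟨0, hb⟩, ⟨0, hb⟩, Function.update (fun _ => 0) j i'⟩)
    (by simp [Omits]) (by simpa [Omits] using hi'.symm) ?_
  rintro (i'' | q | _ | _ | r | ⟨j', m⟩) hne <;> simp only [facetVal] <;> try exact le_rfl
  have h0 := Finset.sum_nonneg fun m (_ : m ∈ Finset.univ) =>
    summandDefect_nonneg ha .ztv (⟨0, hb⟩ : Fin b) ⟨0, hb⟩ (α j' m)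
  rcases eq_or_ne j' j with rfl | hj
  · have : m ≠ i := fun h => hne (h ▸ rfl)
    simp only [Function.update_self, if_neg this]
    split_ifs <;> linarith
  · simp [hj]

lemma not_removable_z (ha : 2 ≤ a) (hb : 1 ≤ b) (hp : IsConfig α p) :
    ¬ IsSmoothFanoSet (Set.range p \ {p .z}) := by
  have haR : (2 : ℝ) ≤ a := by exact_mod_cast ha
  have hbR : (1 : ℝ) ≤ b := by exact_mod_cast hb
  have hY : Kind.yzu.defectY a b ≤ Kind.tuy.defectY a b := by
    simp only [Kind.defectY]
    linarith
  have hU : Kind.yzu.defectU a b ≤ Kind.tuy.defectU a b := by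
    simp only [Kind.defectU]
    linarith
  refine hp.not_removable_of_fn ha hb (κ := .yzu) (κ' := .tuy)
    (T := ⟨⟨0, by omega⟩, ⟨0, hb⟩, ⟨0, hb⟩, fun _ => 0⟩)
    (T' := ⟨⟨0, by omega⟩, ⟨0, hb⟩, ⟨0, hb⟩, fun _ => 0⟩)
    (by simp [Omits]) (by simp [Omits]) ?_
  rintro (i | q | _ | _ | r | ⟨j, m⟩) hne <;> simp only [facetVal]
  · exact le_rfl
  · split_ifs <;> linarith
  · exact absurd rfl hne
  · norm_num [Kind.defectT]
  · split_ifs <;> linarith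
  · have : ∀ m, summandDefect a .yzu (⟨0, hb⟩ : Fin b) ⟨0, hb⟩ (α j m) ≤
        summandDefect a .tuy (⟨0, hb⟩ : Fin b) ⟨0, hb⟩ (α j m) := by
      intro m
      cases α j m <;> simp only [summandDefect] <;> split_ifs <;> first | exact le_rfl | assumption
    have := Finset.sum_le_sum fun m (_ : m ∈ Finset.univ) => this m
    split_ifs <;> linarith

/-- The facet of kind `tuy` would have no neighbour across the ridge opposite to `z`. -/
lemma not_removable_t (ha : 2 ≤ a) (hb : 1 ≤ b) (hl : ∀ j, 1 ≤ l j) (hp : IsConfig α p) :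
    ¬ IsSmoothFanoSet (Set.range p \ {p .t}) := by
  intro hW
  have haR : (2 : ℝ) ≤ a := by exact_mod_cast ha
  have hbR : (1 : ℝ) ≤ b := by exact_mod_cast hb
  obtain ⟨h, hh, hle, hint, h1, e, het, heo, he1, -⟩ := hp.exists_cross ha hb hl hW (κ := .tuy)
    (x₀ := .z) (T := ⟨⟨0, by omega⟩, ⟨0, hb⟩, ⟨0, hb⟩, fun _ => 0⟩)
    (by simp [Omits]) (by simp [Omits])
  have hv : ∑ i, h (.v i) = a := by
    simpa using sum_eq_card _ fun i => h1 (.v i) (by simp [Omits]) (by simp)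
  have e1 := hh.vy
  have e2 := hh.yz
  have e3 := hh.zt
  rw [nsmul_eq_mul, hv] at e1
  push_cast at e1
  rcases e with i | q | _ | _ | r | ⟨j, m⟩ <;> simp [Omits] at heo
  · -- All `v` and `y` have the value `1`, so `t` has the value `1 + 1 / (a + b - 1)`.
    subst heo
    have hy : ∑ q, h (.y q) = b := by
      refine (sum_eq_card _ fun q => ?_).trans (by simp)
      by_cases hq : q = ⟨0, hb⟩
      · rw [hq, he1]
      · exact h1 _ (by simpa [Omits] using hq) (by simp)
    rw [hy] at e1
    have : h .t < 2 := by nlinarith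
    have := le_one_of_lt_two (hint .t) this
    nlinarith
  · exact het rfl
  · -- All `v` and `u` have the value `1`, so `t` and hence some `y q` has a greater value.
    subst heo
    have hu : ∑ q, h (.u q) = b := by
      refine (sum_eq_card _ fun q => ?_).trans (by simp)
      by_cases hq : q = ⟨0, hb⟩
      · rw [hq, he1]
      · exact h1 _ (by simpa [Omits] using hq) (by simp)
    have hy : ∑ q, h (.y q) ≤ b := by
      simpa using sum_le_card _ fun q => hle (.y q) (by simp)
    nlinarith
  · refine hh.false_of_summand_le_one (j := j) (fun m => ?_) (fun i => ?_)
    · rw [summand]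
      cases α j m
      · exact hle _ (by simp)
      · exact hle _ (by simp)
    · by_cases hi : i = 0
      · rw [hi, ← heo, he1]
      · exact h1 _ (by simpa [Omits] using hi) (by simp)

/-- Across the ridge opposite to a vertex `v i`, the facet of kind `yzu` could only have a neighbour
on which `y q₀` has the value `2`. This contradicts a relation of a block `w j` in which `y q₀`
occurs. -/
lemma not_removable_y (ha : 2 ≤ a) (hb : 1 ≤ b) (hl : ∀ j, 1 ≤ l j) (hp : IsConfig α p) (q₀ : Fin b)
    (hq₀ : ∃ j m, α j m = .inl q₀) : ¬ IsSmoothFanoSet (Set.range p \ {p (.y q₀)}) := by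
  intro hW
  obtain ⟨h, hh, hle, hint, h1, e, hey, heo, he1, hlt⟩ := hp.exists_cross ha hb hl hW (κ := .yzu)
    (x₀ := .v ⟨0, by omega⟩) (T := ⟨⟨0, by omega⟩, q₀, ⟨0, hb⟩, fun _ => 0⟩)
    (by simp [Omits]) (by simp [Omits])
  have e2 := hh.yz
  have e3 := hh.zt
  have ht : h .t = 1 := h1 _ (by simp [Omits]) (by simp)
  have hy : ∀ q, q ≠ q₀ → h (.y q) = 1 := fun q hq => h1 _ (by simpa [Omits] using hq) (by simp)
  have hu : ∀ q, q ≠ ⟨0, hb⟩ → h (.u q) = 1 :=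
    fun q hq => h1 _ (by simpa [Omits] using hq) (by simp)
  have hw : ∀ j i, i ≠ 0 → h (.w j i) = 1 :=
    fun j i hi => h1 _ (by simpa [Omits] using hi) (by simp)
  rw [sum_eq_card_add _ q₀ hy, sum_eq_card_add _ _ hu] at e2
  rcases e with i | q | _ | _ | r | ⟨j, m⟩ <;> simp [Omits] at heo
  · exact hey (heo ▸ rfl)
  · linarith
  · -- All `u` and `t` have the value `1`, hence `y q₀` has the value `2`.
    subst heo
    obtain ⟨j, m, hm⟩ := hq₀
    refine hh.false_of_summand_eq_two (j := j) (m := m) (x := .y q₀) (by simp [summand, hm])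
      (by linarith) ?_ (hw j) (hlt _ (by simp) (by simp) (by simp [Omits]))
    intro j m
    rw [summand]
    rcases α j m with q | q <;> intro hne
    · exact hy q (fun h => hne (h ▸ rfl))
    · by_cases hq : q = ⟨0, hb⟩
      · simpa [hq] using he1
      · exact hu q hq
  · have hlt' := hlt (.u ⟨0, hb⟩) (by simp) (by simp) (by simp [Omits])
    have hyle : h (.y q₀) ≤ 1 := le_one_of_lt_two (hint _) (by linarith)
    refine hh.false_of_summand_le_one (j := j) (fun m => ?_) (fun i => ?_)
    · rw [summand]
      rcases α j m with q | q
      · by_cases hq : q = q₀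
        · exact hq ▸ hyle
        · exact (hy q hq).le
      · exact hle _ (by simp)
    · by_cases hi : i = 0
      · rw [hi, ← heo, he1]
      · exact hw j i hi

/-- The mirror image of `not_removable_y`, starting from a facet of kind `tuy`. -/
lemma not_removable_u (ha : 2 ≤ a) (hb : 1 ≤ b) (hl : ∀ j, 1 ≤ l j) (hp : IsConfig α p) (r₀ : Fin b)
    (hr₀ : ∃ j m, α j m = .inr r₀) : ¬ IsSmoothFanoSet (Set.range p \ {p (.u r₀)}) := by
  intro hW
  obtain ⟨h, hh, hle, hint, h1, e, hey, heo, he1, hlt⟩ := hp.exists_cross ha hb hl hW (κ := .tuy)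
    (x₀ := .v ⟨0, by omega⟩) (T := ⟨⟨0, by omega⟩, ⟨0, hb⟩, r₀, fun _ => 0⟩)
    (by simp [Omits]) (by simp [Omits])
  have e2 := hh.yz
  have e3 := hh.zt
  have hz : h .z = 1 := h1 _ (by simp [Omits]) (by simp)
  have hu : ∀ q, q ≠ r₀ → h (.u q) = 1 := fun q hq => h1 _ (by simpa [Omits] using hq) (by simp)
  have hy : ∀ q, q ≠ ⟨0, hb⟩ → h (.y q) = 1 :=
    fun q hq => h1 _ (by simpa [Omits] using hq) (by simp)
  have hw : ∀ j i, i ≠ 0 → h (.w j i) = 1 :=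
    fun j i hi => h1 _ (by simpa [Omits] using hi) (by simp)
  rw [sum_eq_card_add _ r₀ hu, sum_eq_card_add _ _ hy] at e2
  rcases e with i | q | _ | _ | r | ⟨j, m⟩ <;> simp [Omits] at heo
  · -- All `y` and `z` have the value `1`, hence `u r₀` has the value `2`.
    subst heo
    obtain ⟨j, m, hm⟩ := hr₀
    refine hh.false_of_summand_eq_two (j := j) (m := m) (x := .u r₀) (by simp [summand, hm])
      (by linarith) ?_ (hw j) (hlt _ (by simp) (by simp) (by simp [Omits]))
    intro j m
    rw [summand]
    rcases α j m with q | q <;> intro hne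
    · by_cases hq : q = ⟨0, hb⟩
      · simpa [hq] using he1
      · exact hy q hq
    · exact hu q (fun h => hne (h ▸ rfl))
  · linarith
  · exact hey (heo ▸ rfl)
  · have hlt' := hlt (.y ⟨0, hb⟩) (by simp) (by simp) (by simp [Omits])
    have hule : h (.u r₀) ≤ 1 := le_one_of_lt_two (hint _) (by linarith)
    refine hh.false_of_summand_le_one (j := j) (fun m => ?_) (fun i => ?_)
    · rw [summand]
      rcases α j m with q | q
      · exact hle _ (by simp)
      · by_cases hq : q = r₀
        · exact hq ▸ hule
        · exact (hu q hq).le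
    · by_cases hi : i = 0
      · rw [hi, ← heo, he1]
      · exact hw j i hi

/-- No vertex can be removed. -/
theorem not_removable (ha : 2 ≤ a) (hb : 1 ≤ b) (hl : ∀ j, 1 ≤ l j)
    (hα : ∀ s : Fin b ⊕ Fin b, ∃ (j : Fin k) (i : Fin (l j)), α j i = s) (hp : IsConfig α p)
    (x : Label a b k l) : ¬ IsSmoothFanoSet (Set.range p \ {p x}) := by
  cases x with
  | v i => exact hp.not_removable_v ha hb i
  | y q => exact hp.not_removable_y ha hb hl q (hα _)
  | z => exact hp.not_removable_z ha hb
  | t => exact hp.not_removable_t ha hb hl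
  | u r => exact hp.not_removable_u ha hb hl r (hα _)
  | w j i => exact hp.not_removable_w ha hb hl j i

end IsConfig

end FanoPolytope

/-! ### No vertex can be added -/

namespace FanoPolytope

namespace IsConfig

variable {a b k n : ℕ} {l : Fin k → ℕ} {α : (j : Fin k) → Fin (l j) → Fin b ⊕ Fin b}
  {p : Label a b k l → Fin n → ℝ} {x : Fin n → ℝ}

lemma fn_congr (hp : IsConfig α p) {κ : Kind} {T T' : Transversal a b k l}
    (h : ∀ y, Omits κ T' y → Omits κ T y) : hp.fn κ T = hp.fn κ T' :=
  (hp.eq_fn fun y hy => by rw [hp.fn_apply, facetVal_eq_one (fun h' => hy (h y h'))]).symm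

lemma isFacetFn_insert (ha : 2 ≤ a) (hb : 1 ≤ b) (hp : IsConfig α p) {κ : Kind}
    {T : Transversal a b k l} (h : hp.fn κ T x ≤ 1) :
    IsFacetFn (insert x (Set.range p)) (hp.fn κ T) := by
  refine hp.isFacetFn ?_ (fun y _ => Or.inr ⟨y, rfl⟩)
  rintro y (rfl | hy)
  · exact h
  · exact hp.fn_le_one ha hb κ T hy

section

variable (ha : 2 ≤ a) (hb : 1 ≤ b) (hp : IsConfig α p)
  (hV : IsSmoothFanoSet (Set.range p)) (hW : IsSmoothFanoSet (insert x (Set.range p)))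
  (hx : x ∉ Set.range p)

include ha hb hp hV hW hx

/-- A new vertex is either strictly below the hyperplane of a facet or beyond it. -/
lemma fn_le_zero_of_le_one {κ : Kind} {T : Transversal a b k l} (h : hp.fn κ T x ≤ 1) :
    hp.fn κ T x ≤ 0 := by
  have hg := hp.isFacetFn_insert ha hb h
  refine hW.le_zero_of_lt_one hg (hW.subset_lattice (Set.mem_insert _ _)) (lt_of_le_of_ne h ?_)
  intro h1
  have hset : {y ∈ insert x (Set.range p) | hp.fn κ T y = 1} =
      insert x {y ∈ Set.range p | hp.fn κ T y = 1} := by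
    ext y
    constructor
    · rintro ⟨rfl | hy, h⟩
      · exact Or.inl rfl
      · exact Or.inr ⟨hy, h⟩
    · rintro (rfl | ⟨hy, h⟩)
      · exact ⟨Or.inl rfl, h1⟩
      · exact ⟨Or.inr hy, h⟩
  have e1 := hW.ncard_facet hg
  have e2 := hV.ncard_facet (hp.isFacetFn_range ha hb κ T)
  rw [hset, Set.ncard_insert_of_notMem (fun h => hx h.1)
    (hV.finite.subset (Set.sep_subset _ _)), e2] at e1
  omega

/-- The condition on a new vertex that is beyond a facet, but not beyond a neighbouring one. -/
lemma wall {κ κ' : Kind} {T T' : Transversal a b k l} (x₀ e : Label a b k l)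
    (h : hp.fn κ T x ≤ 0) (h' : 0 < hp.fn κ' T' x) (hx₀ : ¬ Omits κ T x₀) (he : Omits κ T e)
    (he' : ¬ Omits κ' T' e) (hridge : ∀ y, Omits κ' T' y → Omits κ T y ∨ y = x₀)
    (hval : facetVal α κ' T' x₀ = facetVal α κ T e) :
    hp.fn κ T x - hp.fn κ' T' x = facetVal α κ T e - 1 ∧ facetVal α κ T e < hp.fn κ T x := by
  have hbeyond : 1 < hp.fn κ' T' x := by
    by_contra hle
    have := hp.fn_le_zero_of_le_one ha hb hV hW hx (not_lt.1 hle)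
    linarith
  have := hW.neighbor_eq_of_beyond (hp.isFacetFn_insert ha hb (h.trans zero_le_one))
    (x := x) (x₀ := p x₀) (e := p e) (g' := hp.fn κ' T') (Or.inl rfl) (Or.inr ⟨_, rfl⟩)
    (by rw [hp.fn_apply, facetVal_eq_one hx₀]) (Or.inr ⟨_, rfl⟩)
    (by rw [hp.fn_apply]; linarith [facetVal_le_zero (α := α) ha hb he])
    (by
      rintro y (rfl | hy) hne
      · exact absurd rfl hne
      · exact hp.fn_le_one ha hb κ' T' hy)
    (by
      rintro y (rfl | ⟨y, rfl⟩) h1 hne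
      · linarith
      · rw [hp.fn_apply] at h1 ⊢
        refine facetVal_eq_one fun ho => ?_
        rcases hridge y ho with ho' | rfl
        · exact (facetVal_eq_one_iff ha hb).1 h1 ho'
        · exact hne rfl)
    (by rw [hp.fn_apply, facetVal_eq_one he'])
    (by rw [hp.fn_apply, hp.fn_apply, hval]) hbeyond
  rwa [hp.fn_apply] at this

/-- A new vertex cannot be separated from a facet by a wall of degree one. -/
lemma wall_of_degree_one {κ κ' : Kind} {T T' : Transversal a b k l} (x₀ e : Label a b k l)
    (h : hp.fn κ T x ≤ 0) (hx₀ : ¬ Omits κ T x₀) (he : Omits κ T e)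
    (he' : ¬ Omits κ' T' e) (hridge : ∀ y, Omits κ' T' y → Omits κ T y ∨ y = x₀)
    (hval : facetVal α κ' T' x₀ = 0) (hval' : facetVal α κ T e = 0) :
    hp.fn κ' T' x ≤ 0 := by
  by_contra h'
  have := (hp.wall ha hb hV hW hx x₀ e h (not_le.1 h') hx₀ he he' hridge
    (hval.trans hval'.symm)).2
  linarith

lemma ztv_of_vyt {T : Transversal a b k l} (h : hp.fn .vyt T x ≤ 0) : hp.fn .ztv T x ≤ 0 := by
  refine hp.wall_of_degree_one ha hb hV hW hx .z (.y T.q) h (by simp [Omits]) (by simp [Omits])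
    (by simp [Omits]) ?_ (by simp [facetVal, Kind.defectZ]) (by simp [facetVal, Kind.defectY])
  rintro (i | q | _ | _ | r | ⟨j, i⟩) ho <;> simp_all [Omits]

lemma vyt_of_ztv {T : Transversal a b k l} (h : hp.fn .ztv T x ≤ 0) : hp.fn .vyt T x ≤ 0 := by
  refine hp.wall_of_degree_one ha hb hV hW hx (.y T.q) .z h (by simp [Omits]) (by simp [Omits])
    (by simp [Omits]) ?_ (by simp [facetVal, Kind.defectY]) (by simp [facetVal, Kind.defectZ])
  rintro (i | q | _ | _ | r | ⟨j, i⟩) ho <;> simp_all [Omits]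

lemma uvz_of_ztv {T : Transversal a b k l} (h : hp.fn .ztv T x ≤ 0) : hp.fn .uvz T x ≤ 0 := by
  refine hp.wall_of_degree_one ha hb hV hW hx (.u T.r) .t h (by simp [Omits]) (by simp [Omits])
    (by simp [Omits]) ?_ (by simp [facetVal, Kind.defectU]) (by simp [facetVal, Kind.defectT])
  rintro (i | q | _ | _ | r | ⟨j, i⟩) ho <;> simp_all [Omits]

lemma ztv_of_uvz {T : Transversal a b k l} (h : hp.fn .uvz T x ≤ 0) : hp.fn .ztv T x ≤ 0 := by
  refine hp.wall_of_degree_one ha hb hV hW hx .t (.u T.r) h (by simp [Omits]) (by simp [Omits])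
    (by simp [Omits]) ?_ (by simp [facetVal, Kind.defectT]) (by simp [facetVal, Kind.defectU])
  rintro (i | q | _ | _ | r | ⟨j, i⟩) ho <;> simp_all [Omits]

lemma yzu_of_uvz {T : Transversal a b k l} (h : hp.fn .uvz T x ≤ 0) : hp.fn .yzu T x ≤ 0 := by
  refine hp.wall_of_degree_one ha hb hV hW hx (.y T.q) (.v T.i) h (by simp [Omits])
    (by simp [Omits]) (by simp [Omits]) ?_ (by simp [facetVal, Kind.defectY])
    (by simp [facetVal, Kind.defectV])
  rintro (i | q | _ | _ | r | ⟨j, i⟩) ho <;> simp_all [Omits]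

lemma uvz_of_yzu {T : Transversal a b k l} (h : hp.fn .yzu T x ≤ 0) : hp.fn .uvz T x ≤ 0 := by
  refine hp.wall_of_degree_one ha hb hV hW hx (.v T.i) (.y T.q) h (by simp [Omits])
    (by simp [Omits]) (by simp [Omits]) ?_ (by simp [facetVal, Kind.defectV])
    (by simp [facetVal, Kind.defectY])
  rintro (i | q | _ | _ | r | ⟨j, i⟩) ho <;> simp_all [Omits]

lemma ztv_update_w {T : Transversal a b k l} (h : hp.fn .ztv T x ≤ 0) (j : Fin k)
    (m : Fin (l j + 1)) :
    hp.fn .ztv { T with s := Function.update T.s j m } x ≤ 0 := by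
  rcases eq_or_ne m (T.s j) with rfl | hne
  · rwa [Function.update_eq_self]
  have hd : ∀ i : Fin (l j), summandDefect a .ztv T.q T.r (α j i) = 0 := by
    intro i
    cases α j i <;> simp [summandDefect, Kind.defectY, Kind.defectU]
  refine hp.wall_of_degree_one ha hb hV hW hx (.w j m) (.w j (T.s j)) h (by simpa [Omits] using hne)
    (by simp [Omits]) (by simpa [Omits] using hne.symm) ?_ (by simp [facetVal, hd])
    (by simp [facetVal, hd])
  rintro (i | q | _ | _ | r | ⟨j', i⟩) ho
  iterate 5 exact Or.inl ho
  simp only [Omits] at ho ⊢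
  rcases eq_or_ne j' j with rfl | hj
  · right
    rw [ho]
    simp
  · left
    simpa [hj] using ho

/-- The facets of the four kinds other than `tuy` are connected by walls of degree one. -/
lemma ztv_of_ztv {T : Transversal a b k l} (h : hp.fn .ztv T x ≤ 0) (T' : Transversal a b k l) :
    hp.fn .ztv T' x ≤ 0 := by
  classical
  have hs : ∀ S : Finset (Fin k), hp.fn .ztv { T with s := S.piecewise T'.s T.s } x ≤ 0 := by
    intro S
    induction S using Finset.induction_on with
    | empty => simpa using h
    | insert j S _ ih =>
      have := hp.ztv_update_w ha hb hV hW hx ih j (T'.s j)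
      rwa [Finset.piecewise_insert]
  have h1 := hs Finset.univ
  rw [Finset.piecewise_univ] at h1
  have h2 := hp.yzu_of_uvz ha hb hV hW hx (hp.uvz_of_ztv ha hb hV hW hx h1)
  rw [hp.fn_congr (T' := { T with i := T'.i, s := T'.s }) (by
    rintro (i | q | _ | _ | r | ⟨j', i⟩) ho <;> simp_all [Omits])] at h2
  have h3 := hp.ztv_of_uvz ha hb hV hW hx (hp.uvz_of_yzu ha hb hV hW hx h2)
  rwa [hp.fn_congr (T' := T') (by
    rintro (i | q | _ | _ | r | ⟨j', i⟩) ho <;> simp_all [Omits])] at h3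

lemma ztv_of_ne_tuy {κ : Kind} (hκ : κ ≠ .tuy) {T : Transversal a b k l}
    (h : hp.fn κ T x ≤ 0) : hp.fn .ztv T x ≤ 0 := by
  cases κ with
  | vyt => exact hp.ztv_of_vyt ha hb hV hW hx h
  | yzu => exact hp.ztv_of_uvz ha hb hV hW hx (hp.uvz_of_yzu ha hb hV hW hx h)
  | ztv => exact h
  | tuy => exact absurd rfl hκ
  | uvz => exact hp.ztv_of_uvz ha hb hV hW hx h

lemma of_ztv {κ : Kind} (hκ : κ ≠ .tuy) {T : Transversal a b k l}
    (h : hp.fn .ztv T x ≤ 0) : hp.fn κ T x ≤ 0 := by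
  cases κ with
  | vyt => exact hp.vyt_of_ztv ha hb hV hW hx h
  | yzu => exact hp.yzu_of_uvz ha hb hV hW hx (hp.uvz_of_ztv ha hb hV hW hx h)
  | ztv => exact h
  | tuy => exact absurd rfl hκ
  | uvz => exact hp.uvz_of_ztv ha hb hV hW hx h

omit hx in
lemma eq_zero_of_neg_one_lt {κ : Kind} {T : Transversal a b k l} (h : hp.fn κ T x ≤ 0)
    (h' : -1 < hp.fn κ T x) : hp.fn κ T x = 0 := by
  obtain ⟨m, hm⟩ := hV.exists_int (hp.isFacetFn_range ha hb κ T)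
    (hW.subset_lattice (Set.mem_insert x _))
  rw [hm] at h h' ⊢
  have h1 : m ≤ 0 := by exact_mod_cast h
  have h2 : -1 < m := by exact_mod_cast h'
  exact_mod_cast (by omega : m = 0)

/-- No new vertex can be added. -/
theorem not_addable (hx0 : x ≠ 0) : False := by
  have haR : (2 : ℝ) ≤ a := by exact_mod_cast ha
  have hbR : (1 : ℝ) ≤ b := by exact_mod_cast hb
  have hne : ∃ g, IsFacetFn (Set.range p) g :=
    ⟨_, hp.isFacetFn_range ha hb .ztv ⟨⟨0, by omega⟩, ⟨0, hb⟩, ⟨0, hb⟩, fun _ => 0⟩⟩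
  obtain ⟨g₁, hg₁, hcone₁⟩ := hV.exists_facet_cone hne x
  obtain ⟨g₂, hg₂, hcone₂⟩ := hV.exists_facet_cone hne (-x)
  obtain ⟨κ₁, T₁, rfl⟩ := hp.exists_eq_fn ha hb hg₁
  obtain ⟨κ₂, T₂, rfl⟩ := hp.exists_eq_fn ha hb hg₂
  have hpos : 0 < hp.fn κ₁ T₁ x := by
    by_contra h
    exact hx0 (hV.eq_zero_of_cone hg₁ hcone₁ (not_lt.1 h))
  have hneg : hp.fn κ₂ T₂ x ≤ 0 := by
    have := hcone₂ (hp.fn κ₂ T₂) (fun y _ h => by rw [h]; exact zero_le_one)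
    rw [map_neg] at this
    linarith
  -- The facets of the four kinds other than `tuy` are not visible from `x`.
  have hgood : ∀ κ T, κ ≠ .tuy → hp.fn κ T x ≤ 0 := by
    suffices ∃ T, hp.fn .ztv T x ≤ 0 by
      obtain ⟨T, hT⟩ := this
      exact fun κ T' hκ => hp.of_ztv ha hb hV hW hx hκ (hp.ztv_of_ztv ha hb hV hW hx hT T')
    by_cases hκ : κ₂ = .tuy
    · subst hκ
      refine ⟨T₂, hp.ztv_of_ne_tuy ha hb hV hW hx (κ := .yzu) (by simp) ?_⟩
      by_contra hbad
      have hw := hp.wall ha hb hV hW hx (κ' := .yzu) (T' := T₂) .z .t hneg (not_le.1 hbad)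
        (by simp [Omits]) (by simp [Omits]) (by simp [Omits]) (by
          rintro (i | q | _ | _ | r | ⟨j, i⟩) ho <;> simp_all [Omits])
        (by simp [facetVal, Kind.defectZ, Kind.defectT])
      simp only [facetVal, Kind.defectT] at hw
      have h0 := hp.eq_zero_of_neg_one_lt ha hb hV hW hneg (by linarith)
      -- The sum of the coordinates other than `z` is nonnegative at `-x`.
      have := hcone₂ (hp.fn .tuy T₂ + hp.fn .yzu T₂) (by
        rintro _ ⟨y, rfl⟩ h1
        rw [LinearMap.add_apply, h1, hp.fn_apply]
        rw [hp.fn_apply, facetVal_eq_one_iff ha hb] at h1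
        rcases y with i | q | _ | _ | r | ⟨j, i⟩ <;> simp [Omits] at h1 <;>
          simp [facetVal, Kind.defectV, Kind.defectZ, h1] <;> norm_num)
      rw [LinearMap.add_apply, map_neg, map_neg] at this
      linarith
    · exact ⟨T₂, hp.ztv_of_ne_tuy ha hb hV hW hx hκ hneg⟩
  have hκ₁ : κ₁ = .tuy := by
    by_contra h
    linarith [hgood κ₁ T₁ h]
  subst hκ₁
  have hz := hp.wall ha hb hV hW hx (κ := .yzu) (T := T₁) .t .z (hgood _ _ (by simp)) hpos
    (by simp [Omits]) (by simp [Omits]) (by simp [Omits]) (by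
      rintro (i | q | _ | _ | r | ⟨j, i⟩) ho <;> simp_all [Omits])
    (by simp [facetVal, Kind.defectZ, Kind.defectT])
  simp only [facetVal, Kind.defectZ] at hz
  have h0 := hp.eq_zero_of_neg_one_lt ha hb hV hW (hgood .yzu T₁ (by simp)) (by linarith)
  have hv : ∀ i : Fin a, hp.fn .vyt { T₁ with i := i } x - hp.fn .tuy T₁ x =
      -(2 * (a + b - 1)) := by
    intro i
    have hw := hp.wall ha hb hV hW hx (κ := .vyt) (T := { T₁ with i := i }) (.u T₁.r) (.v i)
      (hgood _ _ (by simp)) hpos (by simp [Omits]) (by simp [Omits]) (by simp [Omits]) (by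
        rintro (i | q | _ | _ | r | ⟨j, i⟩) ho <;> simp_all [Omits])
      (by
        simp only [facetVal, Kind.defectU, Kind.defectV, if_true]
        ring)
    simp only [facetVal, Kind.defectV, if_true] at hw
    linarith
  -- The coordinates `z`, `v 0` and `v 1` of `x` are all `1`, but the sum of all coordinates is `2`.
  let i₀ : Fin a := ⟨0, by omega⟩
  let i₁ : Fin a := ⟨1, by omega⟩
  have hi : i₀ ≠ i₁ := by simp [i₀, i₁]
  have hc := hcone₁ ((a + b - 1 : ℝ) • (hp.fn .tuy T₁ + hp.fn .yzu T₁) -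
      (hp.fn .tuy T₁ - hp.fn .vyt { T₁ with i := i₀ }) -
      (hp.fn .tuy T₁ - hp.fn .vyt { T₁ with i := i₁ })) (by
    rintro _ ⟨y, rfl⟩ h1
    simp only [LinearMap.sub_apply, LinearMap.add_apply, LinearMap.smul_apply, smul_eq_mul, h1]
    simp only [hp.fn_apply] at h1 ⊢
    rw [facetVal_eq_one_iff ha hb] at h1
    rcases y with i | q | _ | _ | r | ⟨j, i⟩ <;> simp [Omits] at h1 <;>
      simp only [facetVal, Kind.defectV, Kind.defectZ, h1, if_false]
    · by_cases e0 : i = i₀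
      · have e1 : i ≠ i₁ := e0 ▸ hi
        rw [if_pos e0, if_neg e1]
        simp
        linarith
      · rw [if_neg e0]
        split_ifs <;> simp <;> linarith
    all_goals norm_num [Kind.defectU]
    all_goals first | done | linarith)
  simp only [LinearMap.sub_apply, LinearMap.add_apply, LinearMap.smul_apply, smul_eq_mul] at hc
  have e0 := hv i₀
  have e1 := hv i₁
  nlinarith

end

end IsConfig

end FanoPolytope

/-! ### Unimodular equivalence and isolation -/

namespace FanoPolytope

variable {n : ℕ}

lemma zero_mem_intLattice : (0 : Fin n → ℝ) ∈ intLattice n := ⟨0, by ext; simp⟩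

lemma single_mem_intLattice (i : Fin n) : (Pi.single i 1 : Fin n → ℝ) ∈ intLattice n := by
  refine ⟨Pi.single i 1, ?_⟩
  ext c
  rcases eq_or_ne c i with rfl | h
  · simp
  · simp [h]

/-- An affine map of `ℝ ^ n` that maps the lattice onto itself is bijective. -/
lemma bijective_of_image_intLattice {φ : (Fin n → ℝ) →ᵃ[ℝ] (Fin n → ℝ)}
    (hφ : φ '' intLattice n = intLattice n) : Function.Bijective φ := by
  rw [← AffineMap.linear_bijective_iff]
  have hs : Function.Surjective φ.linear := by
    rw [← LinearMap.range_eq_top, eq_top_iff, ← (Pi.basisFun ℝ (Fin n)).span_eq,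
      Submodule.span_le]
    rintro _ ⟨i, rfl⟩
    rw [Pi.basisFun_apply]
    obtain ⟨x, -, hx⟩ := hφ.symm ▸ single_mem_intLattice i
    obtain ⟨x₀, -, hx₀⟩ := hφ.symm ▸ zero_mem_intLattice (n := n)
    refine ⟨x - x₀, ?_⟩
    have := φ.linearMap_vsub x x₀
    rw [hx, hx₀] at this
    simpa using this
  exact ⟨LinearMap.injective_iff_surjective.2 hs, hs⟩

lemma UnimodEquiv.trans_symm {P Q R : Set (Fin n → ℝ)} (h : UnimodEquiv P R)
    (h' : UnimodEquiv Q R) : UnimodEquiv P Q := by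
  obtain ⟨φ, hφl, hφ⟩ := h
  obtain ⟨ψ, hψl, hψ⟩ := h'
  have hψb := bijective_of_image_intLattice hψl
  let e := AffineEquiv.ofBijective hψb
  have he : ∀ S : Set (Fin n → ℝ), e.symm '' (ψ '' S) = S := by
    intro S
    ext x
    simp only [Set.mem_image, exists_exists_and_eq_and]
    constructor
    · rintro ⟨y, hy, rfl⟩
      have : e.symm (ψ y) = y := e.symm_apply_apply y
      rwa [this]
    · exact fun hx => ⟨x, hx, e.symm_apply_apply x⟩
  refine ⟨(e.symm : (Fin n → ℝ) →ᵃ[ℝ] (Fin n → ℝ)).comp φ, ?_, ?_⟩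
  · have := he (intLattice n)
    rw [AffineMap.coe_comp, Set.image_comp, hφl]
    rwa [hψl] at this
  · have := he Q
    rw [AffineMap.coe_comp, Set.image_comp, hφ]
    rwa [hψ] at this

lemma IsSmoothFano.zero_notMem_vertexSet (hn : 0 < n) {P : Set (Fin n → ℝ)}
    (hP : IsSmoothFano P) : (0 : Fin n → ℝ) ∉ vertexSet P := by
  have : Nonempty (Fin n) := ⟨⟨0, hn⟩⟩
  exact fun h => Set.disjoint_left.1 (disjoint_interior_extremePoints P) hP.zero_mem_interior h

namespace IsConfig

variable {a b k : ℕ} {l : Fin k → ℕ} {α : (j : Fin k) → Fin (l j) → Fin b ⊕ Fin b}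
  {p : Label a b k l → Fin n → ℝ}

lemma map (hp : IsConfig α p) (L : (Fin n → ℝ) ≃ₗ[ℝ] (Fin n → ℝ))
    (hL : ∀ x ∈ intLattice n, L x ∈ intLattice n) : IsConfig α (fun x => L (p x)) where
  rel := hp.rel.map L.toLinearMap.toAddMonoidHom
  ext := by
    intro h hh
    obtain ⟨g, hg⟩ := hp.ext h hh
    exact ⟨g ∘ₗ L.symm.toLinearMap, fun x => by simp [hg]⟩
  span := by
    have : Set.range (fun x => L (p x)) = L.toLinearMap '' Set.range p := by
      rw [← Set.range_comp]
      rfl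
    rw [this, Submodule.span_image, hp.span, Submodule.map_top, LinearEquiv.range]
  mem_lattice := fun x => hL _ (hp.mem_lattice x)

/-- A polytope that is equivalent to a realization of the configuration is one, too. An equivalence
has to fix the origin, which is the only lattice point in the interior. -/
lemma exists_of_unimodEquiv (ha : 2 ≤ a) (hb : 1 ≤ b) (hn : 0 < n) (hp : IsConfig α p)
    {P R : Set (Fin n → ℝ)} (hP : IsSmoothFano P) (hR : IsSmoothFano R)
    (hPp : vertexSet P = Set.range p) (h : UnimodEquiv P R) :
    ∃ p' : Label a b k l → Fin n → ℝ, IsConfig α p' ∧ vertexSet R = Set.range p' := by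
  obtain ⟨φ, hφl, rfl⟩ := h
  have hb' := bijective_of_image_intLattice hφl
  have h0 : φ 0 = 0 := by
    obtain ⟨x, hx, hx0⟩ := hφl.symm ▸ zero_mem_intLattice (n := n)
    have hxP : x ∈ interior P := by
      have hi := (AffineEquiv.ofBijective hb').toContinuousAffineEquiv.toHomeomorph.image_interior P
      have h1 := hR.zero_mem_interior
      have h2 : φ '' interior P = interior (φ '' P) := hi
      rw [← h2] at h1
      obtain ⟨x', hx', hx'0⟩ := h1
      rwa [hb'.1 (hx0.trans hx'0.symm)]
    have hV := hP.isSmoothFanoSet hn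
    rw [hPp] at hV
    rw [← hP.isLatticePolytope.convexHull_vertexSet, hPp] at hxP
    have := hV.eq_zero_of_mem_interior
      ⟨_, hp.isFacetFn_range ha hb .ztv ⟨⟨0, by omega⟩, ⟨0, hb⟩, ⟨0, hb⟩, fun _ => 0⟩⟩ hxP hx
    rwa [this] at hx0
  let L := LinearEquiv.ofBijective φ.linear (φ.linear_bijective_iff.2 hb')
  have hL : ∀ x, L x = φ x := by
    intro x
    have := φ.linearMap_vsub x 0
    simpa [h0, L] using this
  refine ⟨_, hp.map L ?_, ?_⟩
  · intro x hx
    rw [hL, ← hφl]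
    exact ⟨x, hx, rfl⟩
  · have h1 : φ '' P = L '' P := Set.image_congr fun x _ => (hL x).symm
    unfold vertexSet at hPp ⊢
    rw [h1, ← image_extremePoints, hPp, ← Set.range_comp]
    rfl

/-- A chain of length zero stays in the equivalence class, and no other chain has a first step. -/
theorem isIIsolated (ha : 2 ≤ a) (hb : 1 ≤ b) (hl : ∀ j, 1 ≤ l j)
    (hα : ∀ s : Fin b ⊕ Fin b, ∃ (j : Fin k) (i : Fin (l j)), α j i = s) (hn : 0 < n)
    (hp : IsConfig α p) {P : Set (Fin n → ℝ)} (hP : IsSmoothFano P)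
    (hPp : vertexSet P = Set.range p) : IsIIsolated P := by
  rintro Q - hPQ ⟨m, R, hR, h0, hm, hstep⟩
  rcases Nat.eq_zero_or_pos m with rfl | hpos
  · exact hPQ (h0.trans_symm hm)
  obtain ⟨p', hp', hV⟩ := hp.exists_of_unimodEquiv ha hb hn hP (hR 0 (Nat.zero_le _)) hPp h0
  have hV0 := (hR 0 (Nat.zero_le _)).isSmoothFanoSet hn
  have hR1 := hR 1 hpos
  have hV1 := hR1.isSmoothFanoSet hn
  rw [hV] at hV0
  obtain ⟨w, ⟨-, hw, hVw⟩ | ⟨-, hw, hVw⟩⟩ := hstep 0 hpos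
  · have h01 := hR1.zero_notMem_vertexSet hn
    rw [hVw, hV, Set.union_singleton] at hV1 h01
    rw [hV] at hw
    exact hp'.not_addable ha hb hV0 hV1 hw (fun h => h01 (h ▸ Set.mem_insert _ _))
  · rw [hV] at hVw
    obtain ⟨y, hy⟩ : w ∈ Set.range p' := hVw ▸ Or.inr rfl
    refine hp'.not_removable ha hb hl hα y ?_
    rw [hVw, hy, Set.union_sdiff_right, Set.sdiff_singleton_eq_self hw]
    exact hV1

end IsConfig

lemma IsIIsolated.isFIsolated {P : Set (Fin n → ℝ)} (h : IsIIsolated P) : IsFIsolated P := by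
  rintro Q hQ hPQ ⟨m, R, hR, h0, hm, hstep⟩
  refine h Q hQ hPQ ⟨m, R, hR, h0, hm, fun i hi => ?_⟩
  obtain ⟨w, h | h⟩ := hstep i hi
  · exact ⟨w, Or.inl h.1⟩
  · exact ⟨w, Or.inr h.1⟩

end FanoPolytope

/-! ### Existence of the configuration -/

namespace FanoPolytope

section Counting

variable {a b k : ℕ} {l : Fin k → ℕ}

/-- The labels, block by block. -/
def labelEquiv (a b k : ℕ) (l : Fin k → ℕ) : Label a b k l ≃
    Fin a ⊕ Fin b ⊕ Unit ⊕ Unit ⊕ Fin b ⊕ (Σ j, Fin (l j + 1)) where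
  toFun
    | .v i => .inl i
    | .y q => .inr (.inl q)
    | .z => .inr (.inr (.inl ()))
    | .t => .inr (.inr (.inr (.inl ())))
    | .u r => .inr (.inr (.inr (.inr (.inl r))))
    | .w j i => .inr (.inr (.inr (.inr (.inr ⟨j, i⟩))))
  invFun
    | .inl i => .v i
    | .inr (.inl q) => .y q
    | .inr (.inr (.inl _)) => .z
    | .inr (.inr (.inr (.inl _))) => .t
    | .inr (.inr (.inr (.inr (.inl r)))) => .u r
    | .inr (.inr (.inr (.inr (.inr ⟨j, i⟩)))) => .w j i
  left_inv x := by cases x <;> rfl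
  right_inv x := by rcases x with i | q | _ | _ | r | ⟨j, i⟩ <;> rfl

noncomputable instance : Fintype (Label a b k l) := Fintype.ofEquiv _ (labelEquiv a b k l).symm

lemma sum_label {M : Type*} [AddCommMonoid M] (f : Label a b k l → M) :
    ∑ x, f x = ∑ i, f (.v i) + (∑ q, f (.y q) + (f .z + (f .t + (∑ r, f (.u r) +
      ∑ j, ∑ i, f (.w j i))))) := by
  rw [← (labelEquiv a b k l).symm.sum_comp]
  simp only [Fintype.sum_sum_type, Fintype.sum_sigma, labelEquiv, Equiv.coe_fn_symm_mk,
    Finset.univ_unique, Finset.sum_singleton]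

lemma card_label : Fintype.card (Label a b k l) = a + 2 * b + 2 + ∑ j, l j + k := by
  rw [Fintype.card_eq_sum_ones, sum_label]
  simp [Finset.sum_add_distrib]
  omega

open Classical in
/-- A maximal simplex leaves out three vertices of the pentagon and one of each block `w j`. -/
lemma card_simplex (κ : Kind) (T : Transversal a b k l) :
    Fintype.card {x // ¬ Omits κ T x} + k + 3 = a + 2 * b + 2 + ∑ j, l j + k := by
  have h : Fintype.card {x // Omits κ T x} = k + 3 := by
    rw [Fintype.card_subtype, Finset.card_filter, sum_label]
    have hw : ∀ j, ∑ i, (if Omits κ T (.w j i) then 1 else 0) = 1 := fun j => by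
      refine (Fintype.sum_eq_single (T.s j) fun i hi => ?_).trans ?_
      · exact if_neg hi
      · exact if_pos rfl
    simp only [hw]
    cases κ <;> simp [Omits]
    all_goals omega
  have := Fintype.card_subtype_compl (fun x => Omits κ T x)
  have hle := Fintype.card_subtype_le (fun x => Omits κ T x)
  rw [card_label] at this hle
  omega

end Counting

section Existence

variable {a b k : ℕ} {l : Fin k → ℕ} {M : Type*} [AddCommGroup M]

/-- The family that satisfies the relations and has the given values at all `y` and `u`, and at all
but the last of the vertices of the blocks `v` and `w j`. -/
def extendRel (α : (j : Fin k) → Fin (l j) → Fin b ⊕ Fin b) (fv : Fin a → M) (fy fu : Fin b → M)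
    (fw : (j : Fin k) → Fin (l j) → M) : Label (a + 1) b k l → M
  | .v i => Fin.snoc (α := fun _ => M) fv
      ((a + b) • (∑ q, fy q - ∑ q, fu q) - ∑ q, fy q - ∑ i, fv i) i
  | .y q => fy q
  | .z => ∑ q, fu q - ∑ q, fy q
  | .t => ∑ q, fy q - ∑ q, fu q
  | .u r => fu r
  | .w j i => Fin.snoc (α := fun _ => M) (fw j) (∑ m, Sum.elim fy fu (α j m) - ∑ i, fw j i) i

lemma isRel_extendRel (α : (j : Fin k) → Fin (l j) → Fin b ⊕ Fin b) (fv : Fin a → M)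
    (fy fu : Fin b → M) (fw : (j : Fin k) → Fin (l j) → M) :
    IsRel α (extendRel α fv fy fu fw) where
  vy := by
    simp only [extendRel, Fin.sum_univ_castSucc, Fin.snoc_castSucc, Fin.snoc_last,
      show a + 1 + b = (a + b) + 1 by omega, succ_nsmul (_ : M) (a + b)]
    abel
  yz := by simp [extendRel]
  zt := by simp [extendRel]
  w := by
    intro j
    simp only [extendRel, Fin.sum_univ_castSucc, Fin.snoc_castSucc, Fin.snoc_last]
    rw [add_sub_cancel]
    refine Finset.sum_congr rfl fun m _ => ?_
    rw [summand]
    cases α j m <;> rfl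

/-- The configuration exists, and its points generate the lattice: take the vertices of a maximal
simplex of kind `ztv` as the standard basis. -/
theorem exists_isConfig {n : ℕ} (hb : 1 ≤ b) (α : (j : Fin k) → Fin (l j) → Fin b ⊕ Fin b)
    (hn : n = a + 2 * b + ∑ j, l j) :
    ∃ (p : Label (a + 1) b k l → Fin n → ℝ) (pZ : Label (a + 1) b k l → Fin n → ℤ),
      IsConfig α p ∧ IsRel α pZ ∧ (∀ x, p x = latticeIncl n (pZ x)) ∧
        Submodule.span ℤ (Set.range pZ) = ⊤ := by
  let T₀ : Transversal (a + 1) b k l := ⟨Fin.last a, ⟨0, hb⟩, ⟨0, hb⟩, fun j => Fin.last (l j)⟩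
  have hcard : Fintype.card (Fin a ⊕ Fin b ⊕ Fin b ⊕ (Σ j, Fin (l j))) = n := by
    simp
    omega
  let e := Fintype.equivFinOfCardEq hcard
  let ι : Fin a ⊕ Fin b ⊕ Fin b ⊕ (Σ j, Fin (l j)) → Label (a + 1) b k l
    | .inl i => .v i.castSucc
    | .inr (.inl q) => .y q
    | .inr (.inr (.inl r)) => .u r
    | .inr (.inr (.inr ⟨j, i⟩)) => .w j i.castSucc
  have hι : ∀ x, ¬ Omits .ztv T₀ x → ∃ c, ι c = x := by
    rintro (i | q | _ | _ | r | ⟨j, i⟩) hx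
    · obtain ⟨i', rfl⟩ := Fin.exists_castSucc_eq.2 (by simpa [Omits] using hx : i ≠ Fin.last a)
      exact ⟨.inl i', rfl⟩
    · exact ⟨.inr (.inl q), rfl⟩
    · simp [Omits] at hx
    · simp [Omits] at hx
    · exact ⟨.inr (.inr (.inl r)), rfl⟩
    · obtain ⟨i', rfl⟩ := Fin.exists_castSucc_eq.2 (by simpa [Omits] using hx : i ≠ Fin.last _)
      exact ⟨.inr (.inr (.inr ⟨j, i'⟩)), rfl⟩
  let pZ : Label (a + 1) b k l → Fin n → ℤ := extendRel α (fun i => Pi.single (e (.inl i)) 1)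
    (fun q => Pi.single (e (.inr (.inl q))) 1) (fun r => Pi.single (e (.inr (.inr (.inl r)))) 1)
    (fun j i => Pi.single (e (.inr (.inr (.inr ⟨j, i⟩)))) 1)
  have hrel : IsRel α pZ := isRel_extendRel α _ _ _ _
  have hpι : ∀ c, pZ (ι c) = Pi.single (e c) 1 := by
    rintro (i | q | r | ⟨j, i⟩) <;> simp [pZ, ι, extendRel]
  have hlι : ∀ c, latticeIncl n (pZ (ι c)) = Pi.single (e c) 1 := by
    intro c
    rw [hpι]
    ext m
    rcases eq_or_ne m (e c) with rfl | h
    · simp [latticeIncl]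
    · simp [latticeIncl, h]
  have hrelR : IsRel α (fun x => latticeIncl n (pZ x)) := hrel.map _
  refine ⟨fun x => latticeIncl n (pZ x), pZ, ⟨hrelR, ?_, ?_, fun x => ⟨_, rfl⟩⟩, hrel,
    fun _ => rfl, ?_⟩
  · intro h hh
    let g := (Pi.basisFun ℝ (Fin n)).constr ℝ (fun m => h (ι (e.symm m)))
    have hg : ∀ c, g (Pi.single (e c) 1) = h (ι c) := by
      intro c
      have := (Pi.basisFun ℝ (Fin n)).constr_basis ℝ (fun m => h (ι (e.symm m))) (e c)
      rw [Pi.basisFun_apply] at this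
      simpa only [Equiv.symm_apply_apply] using this
    refine ⟨g, fun x => ?_⟩
    have := ((hrelR.map g.toAddMonoidHom).sub hh).eq_zero .ztv T₀ (by
      intro x hx
      obtain ⟨c, rfl⟩ := hι x hx
      simp [hlι, hg]) x
    exact sub_eq_zero.1 this
  · rw [eq_top_iff, ← (Pi.basisFun ℝ (Fin n)).span_eq, Submodule.span_le]
    rintro _ ⟨m, rfl⟩
    refine Submodule.subset_span ⟨ι (e.symm m), ?_⟩
    simp [hlι]
  · rw [eq_top_iff, ← (Pi.basisFun ℤ (Fin n)).span_eq, Submodule.span_le]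
    rintro _ ⟨m, rfl⟩
    refine Submodule.subset_span ⟨ι (e.symm m), ?_⟩
    simp [hpι]

end Existence

namespace IsConfig

variable {a b k n : ℕ} {l : Fin k → ℕ} {α : (j : Fin k) → Fin (l j) → Fin b ⊕ Fin b}
  {p : Label a b k l → Fin n → ℝ}

lemma sep_fn_eq_one (ha : 2 ≤ a) (hb : 1 ≤ b) (hp : IsConfig α p) (κ : Kind)
    (T : Transversal a b k l) :
    {y ∈ Set.range p | hp.fn κ T y = 1} = p '' {x | ¬ Omits κ T x} := by
  ext y
  constructor
  · rintro ⟨⟨x, rfl⟩, h⟩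
    rw [hp.fn_apply, facetVal_eq_one_iff ha hb] at h
    exact ⟨x, h, rfl⟩
  · rintro ⟨x, hx, rfl⟩
    exact ⟨⟨x, rfl⟩, by rw [hp.fn_apply, facetVal_eq_one hx]⟩

lemma eq_zero_of_nonneg (hp : IsConfig α p) {f : (Fin n → ℝ) →ₗ[ℝ] ℝ}
    (hf : ∀ x, 0 ≤ f (p x)) : f = 0 := by
  have hr := hp.rel_comp f
  have e1 := hr.vy
  have e2 := hr.yz
  have e3 := hr.zt
  have hz : f (p .z) = 0 := by linarith [hf .z, hf .t]
  have ht : f (p .t) = 0 := by linarith [hf .z, hf .t]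
  have hv0 := Finset.sum_nonneg fun i (_ : i ∈ Finset.univ) => hf (.v i)
  have hy0 := Finset.sum_nonneg fun i (_ : i ∈ Finset.univ) => hf (.y i)
  rw [ht, smul_zero] at e1
  have hv : ∀ i, f (p (.v i)) = 0 := by
    have := (Finset.sum_eq_zero_iff_of_nonneg fun i (_ : i ∈ Finset.univ) => hf (.v i)).1
      (by linarith)
    simpa using this
  have hy : ∀ i, f (p (.y i)) = 0 := by
    have := (Finset.sum_eq_zero_iff_of_nonneg fun i (_ : i ∈ Finset.univ) => hf (.y i)).1
      (by linarith)
    simpa using this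
  have hu : ∀ i, f (p (.u i)) = 0 := by
    have := (Finset.sum_eq_zero_iff_of_nonneg fun i (_ : i ∈ Finset.univ) => hf (.u i)).1
      (by simp [← e2, hy, hz])
    simpa using this
  have hw : ∀ j i, f (p (.w j i)) = 0 := by
    intro j
    have := (Finset.sum_eq_zero_iff_of_nonneg fun i (_ : i ∈ Finset.univ) => hf (.w j i)).1 (by
      rw [hr.w j]
      refine Finset.sum_eq_zero fun m _ => ?_
      rw [summand]
      cases α j m
      · exact hy _
      · exact hu _)
    simpa using this
  refine LinearMap.ext_on hp.span ?_
  rintro _ ⟨x, rfl⟩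
  rcases x with i | q | _ | _ | r | ⟨j, i⟩
  exacts [hv i, hy q, hz, ht, hu r, hw j i]

theorem isSmoothFanoSet (ha : 2 ≤ a) (hb : 1 ≤ b) (hp : IsConfig α p)
    {pZ : Label a b k l → Fin n → ℤ} (hpZ : IsRel α pZ) (hcast : ∀ x, p x = latticeIncl n (pZ x))
    (hspan : Submodule.span ℤ (Set.range pZ) = ⊤) (hn : n + 1 = a + 2 * b + ∑ j, l j) :
    IsSmoothFanoSet (Set.range p) where
  finite := Set.finite_range p
  subset_lattice := by
    rintro _ ⟨x, rfl⟩
    exact hp.mem_lattice x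
  eq_zero_of_nonneg := fun f hf => hp.eq_zero_of_nonneg fun x => hf _ ⟨x, rfl⟩
  facet_basis := by
    classical
    intro g hg
    obtain ⟨κ, T, rfl⟩ := hp.exists_eq_fn ha hb hg
    have hcard : Fintype.card {x // ¬ Omits κ T x} = n := by
      have := card_simplex κ T
      omega
    let σ := (Fintype.equivFinOfCardEq hcard).symm
    have hs : ⊤ ≤ Submodule.span ℤ (Set.range fun m => pZ (σ m).1) := by
      rw [← hspan, Submodule.span_le]
      rintro _ ⟨x, rfl⟩
      have := (hpZ.map (Submodule.mkQ (Submodule.span ℤ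
        (Set.range fun m => pZ (σ m).1))).toAddMonoidHom).eq_zero κ T (fun x hx => by
          have : pZ x ∈ Set.range fun m => pZ (σ m).1 := ⟨σ.symm ⟨x, hx⟩, by simp⟩
          simpa using Submodule.subset_span this) x
      simpa using this
    refine ⟨basisOfTopLeSpanOfCardEqFinrank (fun m => pZ (σ m).1) hs (by simp), ?_⟩
    rw [coe_basisOfTopLeSpanOfCardEqFinrank, hp.sep_fn_eq_one ha hb]
    ext y
    constructor
    · rintro ⟨x, hx, rfl⟩
      refine ⟨σ.symm ⟨x, hx⟩, ?_⟩
      simp only [Equiv.apply_symm_apply]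
      exact (hcast x).symm
    · rintro ⟨m, rfl⟩
      exact ⟨_, (σ m).2, hcast _⟩

end IsConfig

end FanoPolytope

/-! ### Faces, fan and primitive collections -/

namespace FanoPolytope

variable {n : ℕ}

lemma hull_convexHull (S : Set (Fin n → ℝ)) :
    PointedCone.hull ℝ (convexHull ℝ S) = PointedCone.hull ℝ S :=
  le_antisymm (Submodule.span_le.2 (convexHull_min Submodule.subset_span
    (PointedCone.convex _))) (Submodule.span_mono (subset_convexHull ℝ S))

/-- An inequality between functionals passes from a set to the cone generated by it. -/
lemma le_of_mem_hull {S : Set (Fin n → ℝ)} {f g : (Fin n → ℝ) →ₗ[ℝ] ℝ} (h : ∀ x ∈ S, f x ≤ g x)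
    {x : Fin n → ℝ} (hx : x ∈ PointedCone.hull ℝ S) : f x ≤ g x := by
  induction hx using Submodule.span_induction with
  | mem x hx => exact h x hx
  | zero => simp
  | add x y _ _ hx hy =>
    rw [map_add, map_add]
    exact add_le_add hx hy
  | smul c x _ hx =>
    have hc : c • x = (c : ℝ) • x := rfl
    rw [hc, map_smul, map_smul]
    exact mul_le_mul_of_nonneg_left hx c.2

lemma exists_labels {X : Type*} {p : X → Fin n → ℝ} {S : Set (Fin n → ℝ)}
    (hS : S ⊆ Set.range p) : ∃ A : Set X, S = p '' A :=
  ⟨p ⁻¹' S, by rw [Set.image_preimage_eq_inter_range, Set.inter_eq_left.2 hS]⟩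

lemma Prim.eq_of_subset {a b k : ℕ} {l : Fin k → ℕ} (ha : 0 < a) (hb : 0 < b) {π π' : Prim k}
    (h : ∀ x : Label a b k l, π.Mem x → π'.Mem x) : π = π' := by
  have hv := h (.v ⟨0, ha⟩)
  have hy := h (.y ⟨0, hb⟩)
  have hz := h .z
  have ht := h .t
  have hu := h (.u ⟨0, hb⟩)
  have hw := fun j => h (.w j 0)
  cases π <;> cases π' <;> simp_all [Prim.Mem]

lemma exists_not_omits {a b k : ℕ} {l : Fin k → ℕ} (ha : 2 ≤ a) (hb : 1 ≤ b)
    (hl : ∀ j, 1 ≤ l j) (x : Label a b k l) : ∃ κ T, ¬ Omits κ T x := by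
  by_cases hx : x = .z
  · obtain ⟨κ, T, h, -⟩ := exists_omits_separating ha hb hl (x := x) (x' := .t) (by simp [hx])
    exact ⟨κ, T, h⟩
  · obtain ⟨κ, T, h, -⟩ := exists_omits_separating ha hb hl hx
    exact ⟨κ, T, h⟩

/-- A set of labels spans a simplex exactly if it contains no primitive collection. -/
lemma exists_not_omits_iff {a b k : ℕ} {l : Fin k → ℕ} (ha : 2 ≤ a) (hb : 1 ≤ b)
    (α : (j : Fin k) → Fin (l j) → Fin b ⊕ Fin b) (A : Set (Label a b k l)) :
    (∃ κ T, ∀ x ∈ A, ¬ Omits κ T x) ↔ ∀ π : Prim k, ∃ x, π.Mem x ∧ x ∉ A := by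
  constructor
  · rintro ⟨κ, T, h⟩ π
    obtain ⟨x, hx, hlt⟩ := (isRel_facetVal α κ T).exists_lt_one ha hb
      (fun x => facetVal_le_one ha hb κ T x) π
    exact ⟨x, hx, fun hA => hlt.ne (facetVal_eq_one (h x hA))⟩
  · intro h
    obtain ⟨κ, T, h⟩ := exists_omits_of_meets (by omega) (by omega) (fun x => x ∉ A) h
    exact ⟨κ, T, fun x hA ho => h x ho hA⟩

namespace IsConfig

variable {a b k : ℕ} {l : Fin k → ℕ} {α : (j : Fin k) → Fin (l j) → Fin b ⊕ Fin b}
  {p : Label a b k l → Fin n → ℝ}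

/-- Every subset of a maximal simplex is exposed. -/
lemma exists_exposing (ha : 2 ≤ a) (hb : 1 ≤ b) (hl : ∀ j, 1 ≤ l j) (hp : IsConfig α p)
    (hV : IsSmoothFanoSet (Set.range p)) {κ : Kind} {T : Transversal a b k l}
    {A : Set (Label a b k l)} (hA : ∀ x ∈ A, ¬ Omits κ T x) :
    ∃ g : (Fin n → ℝ) →ₗ[ℝ] ℝ, (∀ x ∈ A, g (p x) = 1) ∧ ∀ x ∉ A, g (p x) < 1 := by
  classical
  have hinj := hp.injective ha hb hl
  obtain ⟨B, hB⟩ := hV.exists_basis (hp.isFacetFn_range ha hb κ T)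
  rw [hp.sep_fn_eq_one ha hb] at hB
  let c := B.constr ℝ (fun m => if B m ∈ p '' A then (0 : ℝ) else -1)
  have hc : ∀ x, ¬ Omits κ T x → c (p x) = if x ∈ A then 0 else -1 := by
    intro x hx
    obtain ⟨m, hm⟩ : p x ∈ Set.range B := hB ▸ ⟨x, hx, rfl⟩
    rw [← hm, B.constr_basis, hm]
    simp [hinj.mem_set_image]
  -- The functional of the facet is perturbed so that it drops below `1` on the remaining vertices.
  obtain ⟨M, hM⟩ := (Set.finite_range fun x => c (p x)).bddAbove
  have hpos : 0 < |M| + 1 := by positivity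
  refine ⟨hp.fn κ T + (|M| + 1)⁻¹ • c, ?_, ?_⟩
  · intro x hx
    simp [hp.fn_apply, facetVal_eq_one (hA x hx), hc x (hA x hx), hx]
  · intro x hx
    rw [LinearMap.add_apply, LinearMap.smul_apply, smul_eq_mul, hp.fn_apply]
    by_cases ho : Omits κ T x
    · have h1 := facetVal_le_zero (α := α) ha hb ho
      have h2 : c (p x) ≤ M := hM ⟨x, rfl⟩
      have h3 : (|M| + 1)⁻¹ * c (p x) < 1 := by
        rw [inv_mul_lt_iff₀ hpos]
        linarith [le_abs_self M]
      linarith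
    · rw [facetVal_eq_one ho, hc x ho, if_neg hx]
      have := inv_pos.2 hpos
      linarith

lemma isLatticePolytope (hp : IsConfig α p) : IsLatticePolytope (convexHull ℝ (Set.range p)) :=
  ⟨_, Set.finite_range p, by rintro _ ⟨x, rfl⟩; exact hp.mem_lattice x, rfl⟩

lemma zero_mem_convexHull (hp : IsConfig α p) :
    (0 : Fin n → ℝ) ∈ convexHull ℝ (Set.range p) := by
  have := (convex_convexHull ℝ (Set.range p)) (subset_convexHull ℝ _ ⟨.z, rfl⟩)
    (subset_convexHull ℝ _ ⟨.t, rfl⟩) (a := 1 / 2) (b := 1 / 2) (by norm_num) (by norm_num)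
    (by norm_num)
  rwa [← smul_add, hp.rel.zt, smul_zero] at this

lemma vertexSet_convexHull (ha : 2 ≤ a) (hb : 1 ≤ b) (hl : ∀ j, 1 ≤ l j) (hp : IsConfig α p)
    (hV : IsSmoothFanoSet (Set.range p)) :
    vertexSet (convexHull ℝ (Set.range p)) = Set.range p := by
  refine Set.Subset.antisymm extremePoints_convexHull_subset ?_
  rintro _ ⟨x, rfl⟩
  obtain ⟨κ, T, hx⟩ := exists_not_omits ha hb hl x
  obtain ⟨g, hg1, hg2⟩ := hp.exists_exposing ha hb hl hV (A := {x}) (κ := κ) (T := T)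
    (by rintro _ rfl; exact hx)
  have hle : ∀ y ∈ Set.range p, g y ≤ 1 := by
    rintro _ ⟨y, rfl⟩
    by_cases h : y ∈ ({x} : Set (Label a b k l))
    · exact (hg1 y h).le
    · exact (hg2 y h).le
  have h := convexHull_vertexSet_eq_one hp.isLatticePolytope
    (fun y hy => le_of_mem_convexHull hle hy)
  have hne : (convexHull ℝ {y ∈ vertexSet (convexHull ℝ (Set.range p)) | g y = 1}).Nonempty :=
    h ▸ ⟨p x, subset_convexHull ℝ _ ⟨x, rfl⟩, hg1 x rfl⟩
  obtain ⟨y, hy, hgy⟩ := convexHull_nonempty_iff.1 hne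
  obtain ⟨x', rfl⟩ := extremePoints_convexHull_subset hy
  by_cases hx' : x' = x
  · rwa [← hx']
  · exact absurd hgy (hg2 x' hx').ne

lemma isSmoothFano (ha : 2 ≤ a) (hb : 1 ≤ b) (hl : ∀ j, 1 ≤ l j) (hn : 0 < n)
    (hp : IsConfig α p) (hV : IsSmoothFanoSet (Set.range p)) :
    IsSmoothFano (convexHull ℝ (Set.range p)) :=
  hV.isSmoothFano hn hp.zero_mem_convexHull (hp.vertexSet_convexHull ha hb hl hV)

/-- The cones of the fan are the cones over the subsets of the maximal simplices. -/
lemma hull_mem_fan_iff (ha : 2 ≤ a) (hb : 1 ≤ b) (hl : ∀ j, 1 ≤ l j) (hn : 0 < n)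
    (hp : IsConfig α p) (hV : IsSmoothFanoSet (Set.range p)) (A : Set (Label a b k l)) :
    PointedCone.hull ℝ (p '' A) ∈ fan (convexHull ℝ (Set.range p)) ↔
      ∃ κ T, ∀ x ∈ A, ¬ Omits κ T x := by
  have hvs := hp.vertexSet_convexHull ha hb hl hV
  constructor
  · rintro ⟨F, ⟨hexp, hFP⟩, hF⟩
    obtain ⟨g, hg1, hg2⟩ : ∃ g : (Fin n → ℝ) →ₗ[ℝ] ℝ,
        (∀ x ∈ convexHull ℝ (Set.range p), g x ≤ 1) ∧ ∀ x ∈ F, g x = 1 := by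
      rcases F.eq_empty_or_nonempty with rfl | hne
      · exact ⟨0, by simp, by simp⟩
      · obtain ⟨g, hg, rfl⟩ := exists_eq_one_of_isExposed
          (hp.isSmoothFano ha hb hl hn hV).zero_mem_interior hexp hne hFP
        exact ⟨g, hg, fun x hx => hx.2⟩
    have hgp : ∀ x, g (p x) ≤ 1 := fun x => hg1 _ (subset_convexHull ℝ _ ⟨x, rfl⟩)
    obtain ⟨κ, T, h⟩ := hp.exists_simplex ha hb hgp
    refine ⟨κ, T, fun x hx => h x (le_antisymm (hgp x) ?_)⟩
    -- `g` is at least the functional of a facet that contains `x` on the cone over `F`.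
    obtain ⟨κ', T', hx'⟩ := exists_not_omits ha hb hl x
    have hmem : p x ∈ PointedCone.hull ℝ F := hF ▸ Submodule.subset_span ⟨x, hx, rfl⟩
    have := le_of_mem_hull (f := hp.fn κ' T') (g := g) (fun y hy => by
      rw [hg2 y hy]
      exact le_of_mem_convexHull (fun y hy => hp.fn_le_one ha hb κ' T' hy)
        (hexp.subset hy)) hmem
    rwa [hp.fn_apply, facetVal_eq_one hx'] at this
  · rintro ⟨κ, T, h⟩
    obtain ⟨g, hg1, hg2⟩ := hp.exists_exposing ha hb hl hV h
    have hle : ∀ y ∈ Set.range p, g y ≤ 1 := by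
      rintro _ ⟨y, rfl⟩
      by_cases h : y ∈ A
      · exact (hg1 y h).le
      · exact (hg2 y h).le
    refine ⟨_, ⟨isExposed_eq_one hle, fun h => ?_⟩, ?_⟩
    · have := h ▸ hp.zero_mem_convexHull
      simpa using this.2
    · rw [← convexHull_vertexSet_eq_one hp.isLatticePolytope
        (fun y hy => le_of_mem_convexHull hle hy), hull_convexHull, hvs]
      congr 1
      ext y
      constructor
      · rintro ⟨x, hx, rfl⟩
        exact ⟨⟨x, rfl⟩, hg1 x hx⟩
      · rintro ⟨⟨x, rfl⟩, hx⟩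
        by_contra hne
        exact (hg2 x (fun h => hne ⟨x, h, rfl⟩)).ne hx

/-- The primitive collections are the minimal sets that are not contained in a maximal simplex. -/
lemma isPrimitiveCollection_iff (ha : 2 ≤ a) (hb : 1 ≤ b) (hl : ∀ j, 1 ≤ l j) (hn : 0 < n)
    (hp : IsConfig α p) (hV : IsSmoothFanoSet (Set.range p)) (A : Finset (Fin n → ℝ)) :
    IsPrimitiveCollection (convexHull ℝ (Set.range p)) A ↔
      ∃ π : Prim k, (A : Set (Fin n → ℝ)) = p '' {x | π.Mem x} := by
  have hinj := hp.injective ha hb hl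
  have hface : ∀ S : Set (Label a b k l), PointedCone.hull ℝ (p '' S) ∈
      fan (convexHull ℝ (Set.range p)) ↔ ∀ π : Prim k, ∃ x, π.Mem x ∧ x ∉ S := fun S =>
    (hp.hull_mem_fan_iff ha hb hl hn hV S).trans (exists_not_omits_iff ha hb α S)
  have hdiff : ∀ (S : Set (Label a b k l)) x, p '' S \ {p x} = p '' (S \ {x}) := fun S x => by
    rw [Set.image_sdiff hinj, Set.image_singleton]
  constructor
  · rintro ⟨-, hsub, hnot, hall⟩
    rw [hp.vertexSet_convexHull ha hb hl hV] at hsub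
    obtain ⟨S, hS⟩ := exists_labels hsub
    rw [hS, hface] at hnot
    push Not at hnot
    obtain ⟨π, hπ⟩ := hnot
    refine ⟨π, ?_⟩
    rw [hS]
    congr 1
    refine Set.Subset.antisymm (fun x hx => ?_) (fun x hx => hπ x hx)
    by_contra hxπ
    have hxA : p x ∈ A := by
      rw [← Finset.mem_coe, hS]
      exact ⟨x, hx, rfl⟩
    have := hall (p x) hxA
    rw [hS, hdiff, hface] at this
    obtain ⟨y, hy, hyS⟩ := this π
    refine hyS ⟨hπ y hy, ?_⟩
    rintro rfl
    exact hxπ hy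
  · rintro ⟨π, hπ⟩
    refine ⟨?_, ?_, ?_, ?_⟩
    · rw [← Finset.coe_nonempty, hπ, Set.image_nonempty]
      cases π
      exacts [⟨.y ⟨0, hb⟩, trivial⟩, ⟨.z, trivial⟩, ⟨.z, trivial⟩, ⟨.t, trivial⟩,
        ⟨.u ⟨0, hb⟩, trivial⟩, ⟨.w _ 0, rfl⟩]
    · rw [hπ, hp.vertexSet_convexHull ha hb hl hV]
      exact Set.image_subset_range _ _
    · rw [hπ, hface]
      push Not
      exact ⟨π, fun x hx => hx⟩
    · intro y hy
      rw [← Finset.mem_coe, hπ] at hy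
      obtain ⟨x, hx, rfl⟩ := hy
      rw [hπ, hdiff, hface]
      intro π'
      by_contra! hsub
      have := Prim.eq_of_subset (l := l) (by omega) hb fun y hy => (hsub y hy).1
      subst this
      exact (hsub x hx).2 rfl

/-- A point has at most one expression by the vertices of a cone of the fan. -/
lemma eq_of_sum_eq (ha : 2 ≤ a) (hb : 1 ≤ b) (hl : ∀ j, 1 ≤ l j) (hn : 0 < n)
    (hp : IsConfig α p) (hV : IsSmoothFanoSet (Set.range p)) {c c' : (Fin n → ℝ) →₀ ℕ}
    (hc : (c.support : Set (Fin n → ℝ)) ⊆ Set.range p)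
    (hc' : (c'.support : Set (Fin n → ℝ)) ⊆ Set.range p)
    (hcf : PointedCone.hull ℝ (c.support : Set (Fin n → ℝ)) ∈ fan (convexHull ℝ (Set.range p)))
    (hcf' : PointedCone.hull ℝ (c'.support : Set (Fin n → ℝ)) ∈
      fan (convexHull ℝ (Set.range p)))
    (hsum : c.sum (fun y m => m • y) = c'.sum (fun y m => m • y)) : c = c' := by
  have happ : ∀ (f : (Fin n → ℝ) →ₗ[ℝ] ℝ) (c : (Fin n → ℝ) →₀ ℕ),
      f (c.sum fun y m => m • y) = ∑ y ∈ c.support, c y * f y := by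
    intro f c
    rw [Finsupp.sum, map_sum]
    exact Finset.sum_congr rfl fun y _ => by rw [map_nsmul, nsmul_eq_mul]
  have hfacet : ∀ c : (Fin n → ℝ) →₀ ℕ, (c.support : Set (Fin n → ℝ)) ⊆ Set.range p →
      PointedCone.hull ℝ (c.support : Set (Fin n → ℝ)) ∈ fan (convexHull ℝ (Set.range p)) →
      ∃ g, IsFacetFn (Set.range p) g ∧ ∀ y ∈ c.support, g y = 1 := by
    intro c hc hcf
    obtain ⟨S, hS⟩ := exists_labels hc
    rw [hS, hp.hull_mem_fan_iff ha hb hl hn hV] at hcf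
    obtain ⟨κ, T, h⟩ := hcf
    refine ⟨_, hp.isFacetFn_range ha hb κ T, fun y hy => ?_⟩
    rw [← Finset.mem_coe, hS] at hy
    obtain ⟨x, hx, rfl⟩ := hy
    rw [hp.fn_apply, facetVal_eq_one (h x hx)]
  obtain ⟨g, hg, hg1⟩ := hfacet c hc hcf
  obtain ⟨g', hg', hg1'⟩ := hfacet c' hc' hcf'
  have key : ∀ c c' : (Fin n → ℝ) →₀ ℕ, ∀ g, IsFacetFn (Set.range p) g →
      (c'.support : Set (Fin n → ℝ)) ⊆ Set.range p → (∀ y ∈ c.support, g y = 1) →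
      c.sum (fun y m => m • y) = c'.sum (fun y m => m • y) →
      (∑ y ∈ c.support, (c y : ℝ) = ∑ y ∈ c'.support, (c' y : ℝ) * g y) ∧
      ∑ y ∈ c'.support, (c' y : ℝ) * g y ≤ ∑ y ∈ c'.support, (c' y : ℝ) := by
    intro c c' g hg hc' hg1 hsum
    constructor
    · rw [← happ, ← hsum, happ]
      exact Finset.sum_congr rfl fun y hy => by rw [hg1 y hy, mul_one]
    · refine Finset.sum_le_sum fun y hy => ?_
      have := hg.1 y (hc' hy)
      nlinarith [Nat.cast_nonneg (α := ℝ) (c' y)]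
  have k1 := key c c' g hg hc' hg1 hsum
  have k2 := key c' c g' hg' hc hg1' hsum.symm
  -- The totals agree, so that both expressions live on the same facet.
  have heq : ∑ y ∈ c'.support, (c' y : ℝ) * (1 - g y) = 0 := by
    simp only [mul_sub, mul_one, Finset.sum_sub_distrib]
    linarith [k1.1, k1.2, k2.1, k2.2]
  rw [Finset.sum_eq_zero_iff_of_nonneg (fun y hy => mul_nonneg (Nat.cast_nonneg _)
    (sub_nonneg.2 (hg.1 y (hc' hy))))] at heq
  have hg2 : ∀ y ∈ c'.support, g y = 1 := by
    intro y hy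
    rcases mul_eq_zero.1 (heq y hy) with h | h
    · exact absurd (by exact_mod_cast h) (Finsupp.mem_support_iff.1 hy)
    · linarith
  ext y
  by_cases hy : y ∈ Set.range p ∧ g y = 1
  · obtain ⟨d, hd, hd0⟩ := hV.exists_dual hg hy.1 hy.2
    have hcoef : ∀ c : (Fin n → ℝ) →₀ ℕ, (c.support : Set (Fin n → ℝ)) ⊆ Set.range p →
        (∀ y ∈ c.support, g y = 1) → d (c.sum fun y m => m • y) = c y := by
      intro c hc hg1
      rw [happ, Finset.sum_eq_single y, hd, mul_one]
      · intro x hx hne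
        rw [hd0 x (hc hx) (hg1 x hx) hne, mul_zero]
      · intro h
        rw [Finsupp.notMem_support_iff.1 h]
        simp
    have e1 := hcoef c hc hg1
    have e2 := hcoef c' hc' hg2
    rw [hsum, e2] at e1
    exact_mod_cast e1.symm
  · have h1 : y ∉ c.support := fun h => hy ⟨hc h, hg1 y h⟩
    have h2 : y ∉ c'.support := fun h => hy ⟨hc' h, hg2 y h⟩
    rw [Finsupp.notMem_support_iff.1 h1, Finsupp.notMem_support_iff.1 h2]

end IsConfig

end FanoPolytope

/-! ### Primitive relations -/

namespace FanoPolytope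

variable {n : ℕ}

lemma sum_formalSum {ι : Type*} [Fintype ι] (x : ι → Fin n → ℝ) :
    (formalSum x).sum (fun y m => m • y) = ∑ i, x i := by
  rw [formalSum, ← Finsupp.sum_finsetSum_index (by simp) (by simp [add_smul])]
  simp

lemma support_formalSum_subset {ι : Type*} [Fintype ι] (x : ι → Fin n → ℝ) :
    ((formalSum x).support : Set (Fin n → ℝ)) ⊆ Set.range x := by
  intro y hy
  by_contra hne
  rw [Finset.mem_coe, Finsupp.mem_support_iff, formalSum, Finsupp.finsetSum_apply] at hy
  exact hy (Finset.sum_eq_zero fun i _ => Finsupp.single_eq_of_ne fun h => hne ⟨i, h.symm⟩)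

namespace IsConfig

variable {a b k : ℕ} {l : Fin k → ℕ} {α : (j : Fin k) → Fin (l j) → Fin b ⊕ Fin b}
  {p : Label a b k l → Fin n → ℝ}

/-- The left-hand side of a primitive relation. -/
noncomputable def lhs (p : Label a b k l → Fin n → ℝ) : Prim k → Finset (Fin n → ℝ)
  | .vy => Finset.univ.image (fun i => p (.v i)) ∪ Finset.univ.image (fun q => p (.y q))
  | .yz => Finset.univ.image (fun q => p (.y q)) ∪ {p .z}
  | .zt => {p .z, p .t}
  | .tu => {p .t} ∪ Finset.univ.image (fun r => p (.u r))
  | .uv => Finset.univ.image (fun r => p (.u r)) ∪ Finset.univ.image (fun i => p (.v i))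
  | .w j => Finset.univ.image (fun i => p (.w j i))

/-- The right-hand side of a primitive relation, as a formal sum. -/
noncomputable def rhs (α : (j : Fin k) → Fin (l j) → Fin b ⊕ Fin b)
    (p : Label a b k l → Fin n → ℝ) : Prim k → (Fin n → ℝ) →₀ ℕ
  | .vy => Finsupp.single (p .t) (a + b - 1)
  | .yz => formalSum (fun r => p (.u r))
  | .zt => 0
  | .tu => formalSum (fun q => p (.y q))
  | .uv => Finsupp.single (p .t) (a + b - 2)
  | .w j => formalSum (fun i => p (summand α j i))

lemma coe_lhs (p : Label a b k l → Fin n → ℝ) (π : Prim k) :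
    (lhs p π : Set (Fin n → ℝ)) = p '' {x | π.Mem x} := by
  ext y
  constructor
  · intro hy
    cases π <;> simp [lhs] at hy
    · rcases hy with ⟨i, rfl⟩ | ⟨q, rfl⟩
      exacts [⟨.v i, trivial, rfl⟩, ⟨.y q, trivial, rfl⟩]
    · rcases hy with rfl | ⟨q, rfl⟩
      exacts [⟨.z, trivial, rfl⟩, ⟨.y q, trivial, rfl⟩]
    · rcases hy with rfl | rfl
      exacts [⟨.z, trivial, rfl⟩, ⟨.t, trivial, rfl⟩]
    · rcases hy with rfl | ⟨r, rfl⟩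
      exacts [⟨.t, trivial, rfl⟩, ⟨.u r, trivial, rfl⟩]
    · rcases hy with ⟨r, rfl⟩ | ⟨i, rfl⟩
      exacts [⟨.u r, trivial, rfl⟩, ⟨.v i, trivial, rfl⟩]
    · obtain ⟨i, rfl⟩ := hy
      exact ⟨.w _ i, rfl, rfl⟩
  · rintro ⟨x, hx, rfl⟩
    cases π <;> rcases x with i | q | _ | _ | r | ⟨j, i⟩ <;> simp [Prim.Mem] at hx <;> simp [lhs]
    subst hx
    exact ⟨i, rfl⟩

lemma sum_lhs (ha : 2 ≤ a) (hb : 1 ≤ b) (hl : ∀ j, 1 ≤ l j) (hp : IsConfig α p) (π : Prim k) :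
    ∑ x ∈ lhs p π, x = (rhs α p π).sum (fun y m => m • y) := by
  have hinj := hp.injective ha hb hl
  have hv : Function.Injective fun i => p (.v i) := fun i j h => by simpa using hinj h
  have hy : Function.Injective fun i => p (.y i) := fun i j h => by simpa using hinj h
  have hu : Function.Injective fun i => p (.u i) := fun i j h => by simpa using hinj h
  have hw : ∀ j, Function.Injective fun i => p (.w j i) := fun j i i' h => by simpa using hinj h
  have e1 := hp.rel.vy
  have e2 := hp.rel.yz
  have e3 := hp.rel.zt
  have et : p .t = -p .z := eq_neg_of_add_eq_zero_right e3
  have hs : ∀ m : ℕ, (Finsupp.single (p .t) m).sum (fun y m => m • y) = m • p .t :=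
    fun m => Finsupp.sum_single_index (zero_nsmul _)
  obtain ⟨m, hm⟩ : ∃ m, a + b = m + 2 := ⟨a + b - 2, by omega⟩
  cases π with
  | vy =>
    rw [lhs, Finset.sum_union, Finset.sum_image hv.injOn, Finset.sum_image hy.injOn, rhs,
      hs, hm, show m + 2 - 1 = m + 1 by omega]
    · rw [hm, succ_nsmul _ (m + 1)] at e1
      exact add_right_cancel e1
    · simp [Finset.disjoint_left, hinj.eq_iff]
  | yz =>
    rw [lhs, Finset.sum_union, Finset.sum_image hy.injOn, rhs, sum_formalSum]
    · simpa using e2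
    · simp [hinj.eq_iff]
  | zt =>
    rw [lhs, Finset.sum_pair (hinj.ne (by simp)), rhs]
    simpa using e3
  | tu =>
    rw [lhs, Finset.sum_union, Finset.sum_image hu.injOn, rhs, sum_formalSum]
    · rw [Finset.sum_singleton, ← e2, et]
      abel
    · simp [hinj.eq_iff]
  | uv =>
    rw [lhs, Finset.sum_union, Finset.sum_image hu.injOn, Finset.sum_image hv.injOn, rhs,
      hs, hm, show m + 2 - 2 = m by omega, ← e2]
    · rw [hm, succ_nsmul _ (m + 1), succ_nsmul _ m] at e1
      have := add_right_cancel e1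
      rw [et] at this ⊢
      rw [← sub_eq_iff_eq_add] at this
      rw [← this]
      abel
    · simp [Finset.disjoint_left, hinj.eq_iff]
  | w j =>
    rw [lhs, Finset.sum_image (hw j).injOn, rhs, sum_formalSum]
    exact hp.rel.w j

/-- The right-hand sides are supported on a simplex. -/
lemma exists_support_rhs (hb : 1 ≤ b) (ha : 2 ≤ a) (p : Label a b k l → Fin n → ℝ)
    (π : Prim k) : ∃ S : Set (Label a b k l), ((rhs α p π).support : Set (Fin n → ℝ)) = p '' S ∧
      ∃ κ T, ∀ x ∈ S, ¬ Omits κ T x := by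
  let T₀ : Transversal a b k l := ⟨⟨0, by omega⟩, ⟨0, hb⟩, ⟨0, hb⟩, fun _ => 0⟩
  suffices ∃ S : Set (Label a b k l), ((rhs α p π).support : Set (Fin n → ℝ)) ⊆ p '' S ∧
      ∃ κ T, ∀ x ∈ S, ¬ Omits κ T x by
    obtain ⟨S, hS, κ, T, h⟩ := this
    refine ⟨S ∩ p ⁻¹' (rhs α p π).support, ?_, κ, T, fun x hx => h x hx.1⟩
    rw [Set.image_inter_preimage, Set.inter_eq_right.2 hS]
  have hyu : ∀ {ι : Type} [Fintype ι] (f : ι → Label a b k l),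
      (∀ i, ¬ Omits .ztv T₀ (f i)) →
      ∃ S : Set (Label a b k l), ((formalSum fun i => p (f i)).support : Set (Fin n → ℝ)) ⊆ p '' S ∧
        ∃ κ T, ∀ x ∈ S, ¬ Omits κ T x := by
    intro ι _ f hf
    refine ⟨Set.range f, (support_formalSum_subset _).trans ?_, .ztv, T₀, ?_⟩
    · rintro _ ⟨i, rfl⟩
      exact ⟨_, ⟨i, rfl⟩, rfl⟩
    · rintro _ ⟨i, rfl⟩
      exact hf i
  have ht : ∀ m : ℕ, ∃ S : Set (Label a b k l),
      ((Finsupp.single (p .t) m).support : Set (Fin n → ℝ)) ⊆ p '' S ∧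
        ∃ κ T, ∀ x ∈ S, ¬ Omits κ T x := by
    intro m
    refine ⟨{.t}, ?_, .yzu, T₀, by rintro _ rfl; simp [Omits]⟩
    rw [Set.image_singleton]
    exact fun y hy => by simpa using Finsupp.support_single_subset hy
  cases π with
  | vy => exact ht _
  | yz => exact hyu _ (by simp [Omits])
  | zt => exact ⟨∅, by simp [rhs], .yzu, T₀, by simp⟩
  | tu => exact hyu _ (by simp [Omits])
  | uv => exact ht _
  | w j =>
    refine hyu _ fun i => ?_
    rw [summand]
    cases α j i <;> simp [Omits]

/-- The primitive relations of the configuration. -/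
theorem isPrimitiveRelation_iff (ha : 2 ≤ a) (hb : 1 ≤ b) (hl : ∀ j, 1 ≤ l j) (hn : 0 < n)
    (hp : IsConfig α p) (hV : IsSmoothFanoSet (Set.range p))
    (r : Finset (Fin n → ℝ) × ((Fin n → ℝ) →₀ ℕ)) :
    IsPrimitiveRelation (convexHull ℝ (Set.range p)) r ↔ ∃ π, (lhs p π, rhs α p π) = r := by
  have hrhs : ∀ π, ((rhs α p π).support : Set (Fin n → ℝ)) ⊆ Set.range p ∧
      PointedCone.hull ℝ ((rhs α p π).support : Set (Fin n → ℝ)) ∈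
        fan (convexHull ℝ (Set.range p)) := by
    intro π
    obtain ⟨S, hS, h⟩ := exists_support_rhs hb ha p π
    rw [hS, hp.hull_mem_fan_iff ha hb hl hn hV]
    exact ⟨Set.image_subset_range _ _, h⟩
  unfold IsPrimitiveRelation
  rw [hp.isPrimitiveCollection_iff ha hb hl hn hV, hp.vertexSet_convexHull ha hb hl hV]
  constructor
  · rintro ⟨⟨π, hπ⟩, hsub, hfan, hsum⟩
    have h1 : lhs p π = r.1 := by
      rw [← Finset.coe_inj, coe_lhs, hπ]
    refine ⟨π, Prod.ext h1 ?_⟩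
    refine hp.eq_of_sum_eq ha hb hl hn hV (hrhs π).1 hsub (hrhs π).2 hfan ?_
    rw [← hsum, ← h1, hp.sum_lhs ha hb hl]
  · rintro ⟨π, rfl⟩
    exact ⟨⟨π, coe_lhs p π⟩, (hrhs π).1, (hrhs π).2, hp.sum_lhs ha hb hl π⟩

end IsConfig

end FanoPolytope

theorem theorem4p3 (a b k : ℕ) (ha : 2 ≤ a) (hb : 1 ≤ b) (hk : 1 ≤ k)
    (l : Fin k → ℕ) (hl : ∀ j, 1 ≤ l j)
    -- which of the vertices `y q` (left) and `u q` (right) the summand `α i j` is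
    (α : (j : Fin k) → Fin (l j) → Fin b ⊕ Fin b)
    (hα : ∀ s : Fin b ⊕ Fin b, ∃ (j : Fin k) (i : Fin (l j)), α j i = s)
    (n : ℕ) (hn : n = a + 2 * b - 1 + ∑ j, l j) :
    ∃ (P : Set (Fin n → ℝ)) (v : Fin a → Fin n → ℝ) (y u : Fin b → Fin n → ℝ)
      (z t : Fin n → ℝ) (w : (j : Fin k) → Fin (l j + 1) → Fin n → ℝ),
      FanoPolytope.IsSmoothFano P ∧
      FanoPolytope.IsIIsolated P ∧
      FanoPolytope.IsFIsolated P ∧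
      (FanoPolytope.vertexSet P).ncard = n + k + 3 ∧
      FanoPolytope.vertexSet P =
        Set.range v ∪ Set.range y ∪ {z, t} ∪ Set.range u ∪ ⋃ j, Set.range (w j) ∧
      {r | FanoPolytope.IsPrimitiveRelation P r} =
        {(Finset.univ.image v ∪ Finset.univ.image y, Finsupp.single t (a + b - 1)),
         (Finset.univ.image y ∪ {z}, FanoPolytope.formalSum u),
         ({z, t}, 0),
         ({t} ∪ Finset.univ.image u, FanoPolytope.formalSum y),
         (Finset.univ.image u ∪ Finset.univ.image v, Finsupp.single t (a + b - 2))} ∪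
        Set.range (fun j : Fin k => (Finset.univ.image (w j),
          FanoPolytope.formalSum (fun i : Fin (l j) => Sum.elim y u (α j i)))) := by
  open FanoPolytope in
  obtain ⟨a, rfl⟩ : ∃ a', a = a' + 1 := ⟨a - 1, by omega⟩
  obtain ⟨p, pZ, hp, hpZ, hcast, hspan⟩ := exists_isConfig (n := n) (a := a) hb α (by omega)
  have hV := hp.isSmoothFanoSet ha hb hpZ hcast hspan (by omega)
  have hn0 : 0 < n := by omega
  have hP := hp.isSmoothFano ha hb hl hn0 hV
  have hvs := hp.vertexSet_convexHull ha hb hl hV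
  have hI := hp.isIIsolated ha hb hl hα hn0 hP hvs
  refine ⟨_, fun i => p (.v i), fun q => p (.y q), fun r => p (.u r), p .z, p .t,
    fun j i => p (.w j i), hP, hI, hI.isFIsolated, ?_, ?_, ?_⟩
  · rw [hvs, ← Set.image_univ, Set.ncard_image_of_injective _ (hp.injective ha hb hl),
      Set.ncard_univ, Nat.card_eq_fintype_card, card_label]
    omega
  · rw [hvs]
    ext x
    constructor
    · rintro ⟨i | q | _ | _ | r | ⟨j, i⟩, rfl⟩
      iterate 5 simp
      exact Or.inr (Set.mem_iUnion.2 ⟨j, i, rfl⟩)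
    · simp only [Set.mem_union, Set.mem_range, Set.mem_insert_iff, Set.mem_singleton_iff,
        Set.mem_iUnion]
      rintro ((((⟨i, rfl⟩ | ⟨q, rfl⟩) | rfl | rfl) | ⟨r, rfl⟩) | ⟨j, i, rfl⟩) <;>
        exact ⟨_, rfl⟩
  · have hsummand : ∀ j i, p (summand α j i) =
        Sum.elim (fun q => p (.y q)) (fun r => p (.u r)) (α j i) := by
      intro j i
      rw [summand]
      cases α j i <;> rfl
    ext r
    rw [Set.mem_ofPred_eq, hp.isPrimitiveRelation_iff ha hb hl hn0 hV]
    simp only [← hsummand, Set.mem_union, Set.mem_insert_iff, Set.mem_singleton_iff, Set.mem_range]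
    constructor
    · rintro ⟨π, rfl⟩
      cases π with
      | vy => exact Or.inl (Or.inl rfl)
      | yz => exact Or.inl (Or.inr (Or.inl rfl))
      | zt => exact Or.inl (Or.inr (Or.inr (Or.inl rfl)))
      | tu => exact Or.inl (Or.inr (Or.inr (Or.inr (Or.inl rfl))))
      | uv => exact Or.inl (Or.inr (Or.inr (Or.inr (Or.inr rfl))))
      | w j => exact Or.inr ⟨j, rfl⟩
    · rintro ((rfl | rfl | rfl | rfl | rfl) | ⟨j, rfl⟩)
      exacts [⟨.vy, rfl⟩, ⟨.yz, rfl⟩, ⟨.zt, rfl⟩, ⟨.tu, rfl⟩, ⟨.uv, rfl⟩, ⟨.w j, rfl⟩]
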